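/- Let $k$ be a field of characteristic $0$ and let $G$ be a finite group. A *finite tensor category* over $k$ is a $k$-linear abelian rigid monoidal category with $k$-bilinear tensor product, finite-dimensional morphism spaces, objects of finite length, enough projectives, finitely many simple objects up to isomorphism, and simple unit object $\mathbf 1$ with $\mathrm{End}(\mathbf 1)=k$. For such a category $\mathscr C$ and an object $V$ put $H^\bullet(\mathscr C,V)=\bigoplus_{n\ge 0}\mathrm{Ext}^n_{\mathscr C}(\mathbf 1,V)$. Then $H^\bullet(\mathscr C,\mathbf 1)$ is a graded algebra under the Yoneda product, and it acts on every $H^\bullet(\mathscr C,V)$ by precomposition. The category $\mathscr C$ is *of finite type* if $H^\bullet(\mathscr C,\mathbf 1)$ is a finitely generated $k$-algebra and $H^\bullet(\mathscr C,V)$ is a finitely generated $H^\bullet(\mathscr C,\mathbf 1)$-module for every object $V$. Its *Krull dimension* $\mathrm{Kdim}\,\mathscr C$ is the Krull dimension of the commutative ring $H^{ev}(\mathscr C,\mathbf 1)=\bigoplus_{n\ge 0}\mathrm{Ext}^{2n}_{\mathscr C}(\mathbf 1,\mathbf 1)$. An *action* of $G$ on $\mathscr C$ is a monoidal functor $\rho$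 from $G$ to the $k$-linear tensor autoequivalences of $\mathscr C$. Its *equivariantization* $\mathscr C^G$ is the tensor category of objects $V$ of $\mathscr C$ equipped with isomorphisms $u_g:\rho(g)V\to V$, $g\in G$, such that $u_{gh}=u_g\circ\rho(g)(u_h)$ (identifying $\rho(gh)$ with $\rho(g)\rho(h)$), with morphisms those of $\mathscr C$ that commute with the $u_g$. A *central embedding* $\mathrm{rep}(G)\to\mathscr D$ is a fully faithful tensor functor together with a lift to a braided tensor functor from $\mathrm{rep}(G)$ to the Drinfeld center $Z(\mathscr D)$. Its *de-equivariantization* $\mathscr D_G$ is the tensor category of modules in $\mathscr D$ over the image of the commutative algebra $\mathcal O(G)$ of functions on $G$, with tensor product over $\mathcal O(G)$. **Theorem.** Let $\mathscr C$ and $\mathscr D$ be finite tensor categories over $k$. Suppose that $\mathscr D$ is tensor equivalent to $\mathscr C^G$ for some action of $G$ on $\mathscr C$, or that $\mathscr C$ is tensor equivalent to $\mathscr D_G$ for some central embedding $\mathrm{rep}(G)\to\mathscr D$. Then $\mathscr D$ is of finite type if and only if $\mathscr C$ is of finite type, and in this case $\mathrm{Kdim}\,\mathscr D=\mathrm{Kdim}\,\mathscr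 C$. -/

import Mathlib

open CategoryTheory CategoryTheory.Limits MonoidalCategory
open scoped DirectSum

universe w u v₁ v₂ u₁ u₂

noncomputable section

namespace FinTensor

section Cohomology

open Abelian

variable {C : Type u₁} [Category.{v₁} C] [Abelian C] [HasExt.{w} C]

theorem gradedMk_comp {X Y Z : C} {i j c : ℕ} (a : Ext.{w} X Y i) (b : Ext.{w} Y Z j)
    (h : i + j = c) :
    GradedMonoid.mk (A := fun n => Ext.{w} X Z n) (i + j) (a.comp b rfl) =
      GradedMonoid.mk c (a.comp b h) := by
  subst h; rfl

instance extGMul (X : C) : GradedMonoid.GMul (fun n : ℕ => Ext.{w} X X n) where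
  mul a b := a.comp b rfl

instance extGOne (X : C) : GradedMonoid.GOne (fun n : ℕ => Ext.{w} X X n) where
  one := Ext.mk₀ (𝟙 X)

instance extGMonoid (X : C) : GradedMonoid.GMonoid (fun n : ℕ => Ext.{w} X X n) where
  one_mul a := (gradedMk_comp _ _ (zero_add _)).trans
    (congrArg (GradedMonoid.mk a.1) (Ext.mk₀_id_comp a.2))
  mul_one a := congrArg (GradedMonoid.mk a.1) (Ext.comp_mk₀_id a.2)
  mul_assoc a b c := (congrArg (GradedMonoid.mk (a.1 + b.1 + c.1))
      (Ext.comp_assoc a.2 b.2 c.2 rfl rfl rfl)).trans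
    (gradedMk_comp a.2 (b.2.comp c.2 rfl) (add_assoc _ _ _).symm).symm

instance extGSemiring (X : C) : DirectSum.GSemiring (fun n : ℕ => Ext.{w} X X n) where
  mul_zero a := Ext.comp_zero a _ _ _ _
  zero_mul b := Ext.zero_comp _ _ b _ _
  mul_add a b c := Ext.comp_add a b c rfl
  add_mul a b c := Ext.add_comp a b c rfl
  natCast n := n • Ext.mk₀ (𝟙 X)
  natCast_zero := zero_smul _ _
  natCast_succ n := by rw [add_smul, one_smul]; rfl

instance extGRing (X : C) : DirectSum.GRing (fun n : ℕ => Ext.{w} X X n) where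
  intCast n := n • Ext.mk₀ (𝟙 X)
  intCast_ofNat _ := natCast_zsmul _ _
  intCast_negSucc_ofNat _ := negSucc_zsmul _ _

instance extGmodule (X V : C) :
    DirectSum.Gmodule (fun n : ℕ => Ext.{w} X X n) (fun n : ℕ => Ext.{w} X V n) where
  smul a x := a.comp x rfl
  one_smul x := (gradedMk_comp _ _ (zero_add _)).trans
    (congrArg (GradedMonoid.mk x.1) (Ext.mk₀_id_comp x.2))
  mul_smul a b x := (congrArg (GradedMonoid.mk (a.1 + b.1 + x.1))
      (Ext.comp_assoc a.2 b.2 x.2 rfl rfl rfl)).trans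
    (gradedMk_comp a.2 (b.2.comp x.2 rfl) (add_assoc _ _ _).symm).symm
  smul_add a x y := Ext.comp_add a x y rfl
  smul_zero a := Ext.comp_zero a _ _ _ _
  add_smul a b x := Ext.add_comp a b x rfl
  zero_smul x := Ext.zero_comp _ _ x _ _

variable (k : Type u) [Field k] [Linear k C]

instance extGAlgebra (X : C) : DirectSum.GAlgebra k (fun n : ℕ => Ext.{w} X X n) where
  toFun :=
    { toFun := fun r => Ext.mk₀ (r • 𝟙 X)
      map_zero' := by simp
      map_add' := fun r s => by rw [add_smul, Ext.mk₀_add] }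
  map_one := by
    change Ext.mk₀ ((1 : k) • 𝟙 X) = Ext.mk₀ (𝟙 X)
    rw [one_smul]
  map_mul r s := by
    refine congrArg (GradedMonoid.mk 0) ?_
    change Ext.mk₀ ((r * s) • 𝟙 X) = (Ext.mk₀ (r • 𝟙 X)).comp (Ext.mk₀ (s • 𝟙 X)) (add_zero 0)
    rw [Ext.mk₀_comp_mk₀, Linear.smul_comp, Category.id_comp, mul_smul]
  commutes r x := by
    refine (gradedMk_comp _ x.2 (zero_add _)).trans (congrArg (GradedMonoid.mk x.1) ?_)
    change (Ext.mk₀ (r • 𝟙 X)).comp x.2 _ = x.2.comp (Ext.mk₀ (r • 𝟙 X)) (add_zero _)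
    rw [← Ext.smul_eq_comp_mk₀, Ext.mk₀_smul, Ext.smul_comp, Ext.mk₀_id_comp]
  smul_def r x := by
    refine Eq.trans (congrArg (GradedMonoid.mk x.1) ?_) (gradedMk_comp _ x.2 (zero_add _)).symm
    change r • x.2 = (Ext.mk₀ (r • 𝟙 X)).comp x.2 (zero_add _)
    rw [Ext.mk₀_smul, Ext.smul_comp, Ext.mk₀_id_comp]

/-- The graded `k`-algebra `⨁ n, Ext^n(X, X)`. Products are Yoneda products written in
diagrammatic order, `a * b` being `b ∘ a`, so that `ExtAlgebra X` acts on the left of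
`ExtModule X V`. -/
abbrev ExtAlgebra (X : C) : Type w := ⨁ n : ℕ, Ext.{w} X X n

/-- The graded vector space `⨁ n, Ext^n(X, V)`, a left module over `ExtAlgebra X` through
`a • x = x ∘ a`. -/
abbrev ExtModule (X V : C) : Type w := ⨁ n : ℕ, Ext.{w} X V n

/-- The subring of `ExtAlgebra X` of elements whose components of odd degree vanish. -/
def evenExt (X : C) : Subring (ExtAlgebra.{w} X) where
  carrier := {x | ∀ n : ℕ, Odd n → x n = 0}
  zero_mem' _ _ := rfl
  one_mem' n hn := by
    rw [DirectSum.one_def, DirectSum.of_eq_of_ne]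
    rintro rfl
    exact absurd hn (by decide)
  add_mem' {x y} hx hy n hn := by
    rw [DirectSum.add_apply, hx n hn, hy n hn, add_zero]
  neg_mem' {x} hx n hn := by
    have h : (-x) n = -(x n) := DFinsupp.neg_apply x n
    rw [h, hx n hn, neg_zero]
  mul_mem' {x y} hx hy n hn := by
    classical
    rw [DirectSum.mul_eq_sum_support_ghas_mul]
    rw [DFinsupp.finsetSum_apply]
    refine Finset.sum_eq_zero fun ij hij => ?_
    rw [Finset.mem_product, DFinsupp.mem_support_iff, DFinsupp.mem_support_iff] at hij
    refine DirectSum.of_eq_of_ne _ _ _ ?_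
    rintro rfl
    have h1 : ¬ Odd ij.1 := fun h => hij.1 (hx _ h)
    have h2 : ¬ Odd ij.2 := fun h => hij.2 (hy _ h)
    rw [Nat.not_odd_iff_even] at h1 h2
    exact (Nat.not_odd_iff_even.2 (h1.add h2)) hn

end Cohomology

section TensorCategories

variable (k : Type u) [Field k] (C : Type u₁) [Category.{v₁} C] [Abelian C] [Linear k C]
  [MonoidalCategory C]

/-- A `k`-linear abelian rigid monoidal category with bilinear tensor product is a finite tensor
category if it has finite dimensional morphism spaces, objects of finite length, enough projectives
and finitely many simple objects up to isomorphism, and if its unit is simple with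
endomorphisms `k`. -/
structure IsFiniteTensorCategory [MonoidalPreadditive C] [MonoidalLinear k C]
    [RigidCategory C] : Prop where
  finite_hom (X Y : C) : Module.Finite k (X ⟶ Y)
  noetherian (X : C) : IsNoetherianObject X
  artinian (X : C) : IsArtinianObject X
  enoughProjectives : EnoughProjectives C
  finite_simples : ∃ (n : ℕ) (S : Fin n → C), ∀ X : C, Simple X → ∃ i, Nonempty (X ≅ S i)
  simple_unit : Simple (𝟙_ C)
  end_unit (f : 𝟙_ C ⟶ 𝟙_ C) : ∃ c : k, f = c • 𝟙 (𝟙_ C)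

/-- `C` is of finite type: the cohomology `H(C, 1) = ⨁ n, Ext^n(1, 1)` is a finitely generated
algebra, and each `H(C, V) = ⨁ n, Ext^n(1, V)` is a finitely generated `H(C, 1)`-module. -/
def IsOfFiniteType : Prop :=
  letI : HasExt.{max u₁ v₁} C := HasExt.standard C
  Algebra.FiniteType k (ExtAlgebra.{max u₁ v₁} (𝟙_ C)) ∧
    ∀ V : C, Module.Finite (ExtAlgebra.{max u₁ v₁} (𝟙_ C)) (ExtModule.{max u₁ v₁} (𝟙_ C) V)

/-- The Krull dimension of the (commutative) ring `H^ev(C, 1) = ⨁ n, Ext^(2n)(1, 1)`: the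
supremum of the lengths of chains of prime ideals. -/
def Kdim : WithBot ℕ∞ :=
  letI : HasExt.{max u₁ v₁} C := HasExt.standard C
  Order.krullDim {p : Ideal (evenExt.{max u₁ v₁} (𝟙_ C)) // p.IsPrime}

end TensorCategories

section Equivariantization

open Functor.LaxMonoidal Functor.OplaxMonoidal

section Coherence

variable {C : Type u₁} [Category.{v₁} C] [MonoidalCategory C] (F : C ⥤ C) [F.Monoidal]

theorem tensorHom_comm {X X' Y Y' : C} {u : F.obj X ⟶ X} {u' : F.obj X' ⟶ X'}
    {v : F.obj Y ⟶ Y} {v' : F.obj Y' ⟶ Y'} {f : X ⟶ X'} {f' : Y ⟶ Y'}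
    (hf : u ≫ f = F.map f ≫ u') (hf' : v ≫ f' = F.map f' ≫ v') :
    (δ F X Y ≫ (u ⊗ₘ v)) ≫ (f ⊗ₘ f') = F.map (f ⊗ₘ f') ≫ δ F X' Y' ≫ (u' ⊗ₘ v') := by
  rw [Category.assoc, MonoidalCategory.tensorHom_comp_tensorHom, hf, hf',
    ← δ_natural_assoc, MonoidalCategory.tensorHom_comp_tensorHom]

theorem associator_comm {X Y Z : C} (u : F.obj X ⟶ X) (v : F.obj Y ⟶ Y) (w : F.obj Z ⟶ Z) :
    (δ F (X ⊗ Y) Z ≫ ((δ F X Y ≫ (u ⊗ₘ v)) ⊗ₘ w)) ≫ (α_ X Y Z).hom =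
      F.map (α_ X Y Z).hom ≫ δ F X (Y ⊗ Z) ≫ (u ⊗ₘ (δ F Y Z ≫ (v ⊗ₘ w))) := by
  have h1 : ((δ F X Y ≫ (u ⊗ₘ v)) ⊗ₘ w) =
      (δ F X Y ▷ F.obj Z) ≫ ((u ⊗ₘ v) ⊗ₘ w) := by
    rw [← MonoidalCategory.tensorHom_id, MonoidalCategory.tensorHom_comp_tensorHom,
      Category.id_comp]
  have h2 : (u ⊗ₘ (δ F Y Z ≫ (v ⊗ₘ w))) =
      (F.obj X ◁ δ F Y Z) ≫ (u ⊗ₘ (v ⊗ₘ w)) := by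
    rw [← MonoidalCategory.id_tensorHom, MonoidalCategory.tensorHom_comp_tensorHom,
      Category.id_comp]
  rw [h1, h2, Category.assoc, Category.assoc, MonoidalCategory.associator_naturality,
    Functor.OplaxMonoidal.associativity_assoc]

theorem leftUnitor_comm {X : C} (u : F.obj X ⟶ X) :
    (δ F (𝟙_ C) X ≫ (η F ⊗ₘ u)) ≫ (λ_ X).hom = F.map (λ_ X).hom ≫ u := by
  rw [MonoidalCategory.tensorHom_def, Category.assoc, Category.assoc,
    MonoidalCategory.leftUnitor_naturality, Functor.OplaxMonoidal.left_unitality_hom_assoc]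

theorem rightUnitor_comm {X : C} (u : F.obj X ⟶ X) :
    (δ F X (𝟙_ C) ≫ (u ⊗ₘ η F)) ≫ (ρ_ X).hom = F.map (ρ_ X).hom ≫ u := by
  rw [MonoidalCategory.tensorHom_def', Category.assoc, Category.assoc,
    MonoidalCategory.rightUnitor_naturality, Functor.OplaxMonoidal.right_unitality_hom_assoc]

end Coherence


/-- An action of `G` on `C` by `k`-linear tensor functors: `act g` is the functor of `g`, and
`mulIso`, `oneIso` are monoidal natural isomorphisms `ρ(g) ρ(h) ≅ ρ(gh)` and `id ≅ ρ(1)` subject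
to associativity and unit constraints. The isomorphism `mulIso` is indexed by a proof of
`g * h = m` so that the constraints need no transport. Each `act g` is an equivalence,
with inverse `act g⁻¹`. -/
structure TensorAction (k : Type u) [Field k] (G : Type u) [Group G] (C : Type u₁)
    [Category.{v₁} C] [Preadditive C] [Linear k C] [MonoidalCategory C] where
  act : G → C ⥤ C
  monoidal (g : G) : (act g).Monoidal
  additive (g : G) : (act g).Additive
  linear (g : G) : (act g).Linear k
  mulIso {g h m : G} (e : g * h = m) : act h ⋙ act g ≅ act m
  oneIso : 𝟭 C ≅ act 1
  mulIso_monoidal {g h m : G} (e : g * h = m) : NatTrans.IsMonoidal (mulIso e).hom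
  oneIso_monoidal : NatTrans.IsMonoidal oneIso.hom
  assoc {g h l a b c : G} (e₁ : g * h = a) (e₂ : h * l = b) (e₃ : a * l = c) (e₄ : g * b = c)
    (X : C) : (mulIso e₁).hom.app ((act l).obj X) ≫ (mulIso e₃).hom.app X =
      (act g).map ((mulIso e₂).hom.app X) ≫ (mulIso e₄).hom.app X
  one_left (g : G) (X : C) :
    oneIso.hom.app ((act g).obj X) ≫ (mulIso (one_mul g)).hom.app X = 𝟙 ((act g).obj X)
  one_right (g : G) (X : C) :
    (act g).map (oneIso.hom.app X) ≫ (mulIso (mul_one g)).hom.app X = 𝟙 ((act g).obj X)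

attribute [instance] TensorAction.monoidal TensorAction.additive TensorAction.linear
  TensorAction.mulIso_monoidal TensorAction.oneIso_monoidal

variable {k : Type u} [Field k] {G : Type u} [Group G] {C : Type u₁} [Category.{v₁} C]
  [Preadditive C] [Linear k C] [MonoidalCategory C]

/-- Objects of the equivariantization `C^G`: an object `V` with isomorphisms `u g : ρ(g) V ≅ V`
such that `u (gh) = u g ∘ ρ(g)(u h)` modulo the identification of `ρ(gh)` and `ρ(g) ρ(h)`. As the
`u g` are invertible, `u 1` is the canonical isomorphism. -/
structure Equivariantization (T : TensorAction k G C) where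
  obj : C
  iso (g : G) : (T.act g).obj obj ≅ obj
  comp (g h : G) : (T.mulIso (rfl : g * h = g * h)).hom.app obj ≫ (iso (g * h)).hom =
    (T.act g).map (iso h).hom ≫ (iso g).hom

namespace Equivariantization

variable {T : TensorAction k G C}

/-- Morphisms of `C^G` are the morphisms of `C` that commute with the equivariant structures. -/
@[ext]
structure Hom (V W : Equivariantization T) where
  hom : V.obj ⟶ W.obj
  comm (g : G) : (V.iso g).hom ≫ hom = (T.act g).map hom ≫ (W.iso g).hom

instance : Category (Equivariantization T) where
  Hom := Hom
  id V := ⟨𝟙 V.obj, by simp⟩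
  comp f g := ⟨f.hom ≫ g.hom, fun x => by
    rw [← Category.assoc, f.comm, Category.assoc, g.comm, ← Category.assoc, ← Functor.map_comp]⟩
  id_comp f := Hom.ext (Category.id_comp f.hom)
  comp_id f := Hom.ext (Category.comp_id f.hom)
  assoc f g h := Hom.ext (Category.assoc f.hom g.hom h.hom)

/-- Isomorphisms of `C` that commute with the equivariant structures are isomorphisms of `C^G`. -/
def isoMk {V W : Equivariantization T} (e : V.obj ≅ W.obj)
    (h : ∀ g : G, (V.iso g).hom ≫ e.hom = (T.act g).map e.hom ≫ (W.iso g).hom) : V ≅ W where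
  hom := ⟨e.hom, h⟩
  inv := ⟨e.inv, fun g => by
    rw [Iso.comp_inv_eq, Category.assoc, h, ← Functor.map_comp_assoc, e.inv_hom_id,
      CategoryTheory.Functor.map_id, Category.id_comp]⟩
  hom_inv_id := Hom.ext e.hom_inv_id
  inv_hom_id := Hom.ext e.inv_hom_id

section Linear

variable (V W : Equivariantization T)

/-- Equivariant morphisms form a linear subspace of all morphisms. -/
def homSubmodule : Submodule k (V.obj ⟶ W.obj) where
  carrier := {f | ∀ g : G, (V.iso g).hom ≫ f = (T.act g).map f ≫ (W.iso g).hom}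
  zero_mem' g := by simp
  add_mem' {a b} ha hb g := by
    rw [Preadditive.comp_add, ha g, hb g, Functor.map_add, Preadditive.add_comp]
  smul_mem' c a ha g := by
    rw [Linear.comp_smul, ha g, Functor.map_smul, Linear.smul_comp]

/-- Morphisms of `C^G` are the elements of `homSubmodule`. -/
def homEquiv : (V ⟶ W) ≃ homSubmodule V W where
  toFun f := ⟨Hom.hom f, Hom.comm f⟩
  invFun f := ⟨f.1, f.2⟩

instance : AddCommGroup (V ⟶ W) := (homEquiv V W).addCommGroup
instance : Module k (V ⟶ W) := (homEquiv V W).module k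

instance : Preadditive (Equivariantization T) where
  add_comp U V W f g h := Hom.ext (Preadditive.add_comp U.obj V.obj W.obj f.hom g.hom h.hom)
  comp_add U V W f g h := Hom.ext (Preadditive.comp_add U.obj V.obj W.obj f.hom g.hom h.hom)

instance : Linear k (Equivariantization T) where
  smul_comp U V W r f g := Hom.ext (Linear.smul_comp U.obj V.obj W.obj r f.hom g.hom)
  comp_smul U V W f r g := Hom.ext (Linear.comp_smul U.obj V.obj W.obj f.hom r g.hom)

end Linear

/-- The unit object of `C^G`. -/
def unit (T : TensorAction k G C) : Equivariantization T where
  obj := 𝟙_ C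
  iso g := (Functor.Monoidal.εIso (T.act g)).symm
  comp g h := by
    change _ ≫ η (T.act (g * h)) = (T.act g).map (η (T.act h)) ≫ η (T.act g)
    rw [← cancel_epi (ε (T.act h ⋙ T.act g)), NatTrans.IsMonoidal.unit_assoc,
      Functor.Monoidal.ε_η, Functor.LaxMonoidal.comp_ε, Category.assoc,
      ← Functor.map_comp_assoc, Functor.Monoidal.ε_η, CategoryTheory.Functor.map_id,
      Category.id_comp, Functor.Monoidal.ε_η]

/-- The tensor product of `C^G`, with underlying object `V ⊗ W`. -/
def tensor (V W : Equivariantization T) : Equivariantization T where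
  obj := V.obj ⊗ W.obj
  iso g := (Functor.Monoidal.μIso (T.act g) V.obj W.obj).symm ≪≫ (V.iso g ⊗ᵢ W.iso g)
  comp g h := by
    change _ ≫ δ (T.act (g * h)) V.obj W.obj ≫ ((V.iso (g * h)).hom ⊗ₘ (W.iso (g * h)).hom) =
      (T.act g).map (δ (T.act h) V.obj W.obj ≫ ((V.iso h).hom ⊗ₘ (W.iso h).hom)) ≫
        δ (T.act g) V.obj W.obj ≫ ((V.iso g).hom ⊗ₘ (W.iso g).hom)
    rw [← cancel_epi (μ (T.act h ⋙ T.act g) V.obj W.obj), NatTrans.IsMonoidal.tensor_assoc,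
      Functor.Monoidal.μ_δ_assoc, MonoidalCategory.tensorHom_comp_tensorHom, comp, comp,
      Functor.LaxMonoidal.comp_μ, Category.assoc, ← Functor.map_comp_assoc,
      Functor.Monoidal.μ_δ_assoc, ← Functor.LaxMonoidal.μ_natural_assoc,
      Functor.Monoidal.μ_δ_assoc, MonoidalCategory.tensorHom_comp_tensorHom]

instance : MonoidalCategoryStruct (Equivariantization T) where
  tensorObj V W := tensor V W
  tensorUnit := unit T
  whiskerLeft V _ _ f := ⟨V.obj ◁ Hom.hom f, fun g => by
    rw [← MonoidalCategory.id_tensorHom]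
    exact tensorHom_comm (T.act g) (Hom.comm (𝟙 V) g) (Hom.comm f g)⟩
  whiskerRight f V := ⟨Hom.hom f ▷ V.obj, fun g => by
    rw [← MonoidalCategory.tensorHom_id]
    exact tensorHom_comm (T.act g) (Hom.comm f g) (Hom.comm (𝟙 V) g)⟩
  tensorHom f f' := ⟨Hom.hom f ⊗ₘ Hom.hom f', fun g =>
    tensorHom_comm (T.act g) (Hom.comm f g) (Hom.comm f' g)⟩
  associator U V W := isoMk (α_ U.obj V.obj W.obj) fun g =>
    associator_comm (T.act g) (U.iso g).hom (V.iso g).hom (W.iso g).hom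
  leftUnitor V := isoMk (λ_ V.obj) fun g => leftUnitor_comm (T.act g) (V.iso g).hom
  rightUnitor V := isoMk (ρ_ V.obj) fun g => rightUnitor_comm (T.act g) (V.iso g).hom

instance : MonoidalCategory (Equivariantization T) where
  tensorHom_def f g := Hom.ext (MonoidalCategory.tensorHom_def f.hom g.hom)
  id_tensorHom_id U V := Hom.ext (MonoidalCategory.id_tensorHom_id U.obj V.obj)
  tensorHom_comp_tensorHom f₁ f₂ g₁ g₂ :=
    Hom.ext (MonoidalCategory.tensorHom_comp_tensorHom f₁.hom f₂.hom g₁.hom g₂.hom)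
  whiskerLeft_id U V := Hom.ext (MonoidalCategory.whiskerLeft_id U.obj V.obj)
  id_whiskerRight U V := Hom.ext (MonoidalCategory.id_whiskerRight U.obj V.obj)
  associator_naturality f₁ f₂ f₃ :=
    Hom.ext (MonoidalCategory.associator_naturality f₁.hom f₂.hom f₃.hom)
  leftUnitor_naturality f := Hom.ext (MonoidalCategory.leftUnitor_naturality f.hom)
  rightUnitor_naturality f := Hom.ext (MonoidalCategory.rightUnitor_naturality f.hom)
  pentagon U V W X := Hom.ext (MonoidalCategory.pentagon U.obj V.obj W.obj X.obj)
  triangle U V := Hom.ext (MonoidalCategory.triangle U.obj V.obj)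

end Equivariantization

end Equivariantization

section FunctionAlgebra

open scoped TensorProduct MonObj

variable (k : Type u) [Field k] (G : Type u) [Group G] [Finite G]

/-- Left translation on functions, `(g f)(x) = f(g⁻¹ x)`. -/
def translation : Representation k G (G → k) where
  toFun g := LinearMap.funLeft k k (fun x => g⁻¹ * x)
  map_one' := by ext; simp [LinearMap.funLeft]
  map_mul' g h := by ext; simp [LinearMap.funLeft, mul_assoc]

/-- The algebra `O(G)` of functions on `G`, the linear dual of the group algebra, as an object of
`rep(G)`. -/
def functionAlgebra : FDRep k G := FDRep.of (translation k G)

/-- The unit of `O(G)`, the inclusion of the constant functions. -/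
def functionUnit : 𝟙_ (FDRep k G) ⟶ functionAlgebra k G where
  hom := FGModuleCat.ofHom (V := k) (W := G → k) (Algebra.linearMap k (G → k))
  comm g := by
    apply FGModuleCat.hom_ext
    exact LinearMap.ext fun x => rfl

/-- The pointwise multiplication of functions. -/
def functionMul : functionAlgebra k G ⊗ functionAlgebra k G ⟶ functionAlgebra k G where
  hom := ObjectProperty.homMk (ModuleCat.ofHom (LinearMap.mul' k (G → k)))
  comm g := by
    apply FGModuleCat.hom_ext
    exact TensorProduct.ext' fun x y => rfl

instance : MonObj (functionAlgebra k G) where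
  one := functionUnit k G
  mul := functionMul k G
  one_mul := by
    apply Action.Hom.ext
    apply FGModuleCat.hom_ext
    exact TensorProduct.ext' fun r x => funext fun g => rfl
  mul_one := by
    apply Action.Hom.ext
    apply FGModuleCat.hom_ext
    exact TensorProduct.ext' fun x r => funext fun g => mul_comm (G := k) (x g) r
  mul_assoc := by
    apply Action.Hom.ext
    apply FGModuleCat.hom_ext
    exact TensorProduct.ext_threefold fun x y z => mul_assoc (G := G → k) x y z

instance : IsCommMonObj (functionAlgebra k G) where
  mul_comm := by
    apply Action.Hom.ext
    apply FGModuleCat.hom_ext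
    exact TensorProduct.ext' fun x y => mul_comm (G := G → k) y x

end FunctionAlgebra

section DeEquivariantization

open scoped MonObj

section Rigid

variable {D : Type u₁} [Category.{v₁} D] [MonoidalCategory D] [RigidCategory D]

instance preservesColimits_tensorLeft (X : D) :
    PreservesColimitsOfSize.{0, 0} (tensorLeft X) :=
  (tensorLeftAdjunction (ᘁX) X).leftAdjoint_preservesColimits

instance preservesColimits_tensorRight (X : D) :
    PreservesColimitsOfSize.{0, 0} (tensorRight X) :=
  (tensorRightAdjunction X (Xᘁ)).leftAdjoint_preservesColimits

end Rigid

theorem halfBraiding_act {D : Type u₁} [Category.{v₁} D] [MonoidalCategory D]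
    {A X Y Q : D} (b : HalfBraiding A) {l : A ⊗ X ⟶ X} {r : X ⊗ A ⟶ X}
    {l' : A ⊗ Y ⟶ Y} {r' : Y ⊗ A ⟶ Y} {π : X ⊗ Y ⟶ Q} (h : (b.β X).hom ≫ r = l)
    (h' : (b.β Y).hom ≫ r' = l') (hπ : r ▷ Y ≫ π = ((α_ X A Y).hom ≫ X ◁ l') ≫ π) :
    (b.β (X ⊗ Y)).hom ≫ (α_ X Y A).hom ≫ X ◁ r' ≫ π = (α_ A X Y).inv ≫ l ▷ Y ≫ π := by
  subst h h'
  rw [b.monoidal, MonoidalCategory.comp_whiskerRight]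
  simp only [Category.assoc] at hπ ⊢
  rw [hπ]
  simp

section Bimodules

variable {D : Type u₁} [Category.{v₁} D] [MonoidalCategory D] [HasCoequalizers D]
  [∀ X : D, PreservesColimitsOfSize.{0, 0} (tensorLeft X)]
  [∀ X : D, PreservesColimitsOfSize.{0, 0} (tensorRight X)]

/-- Endomorphisms of an object of a bicategory, with composition as tensor product. -/
abbrev endMonoidal {B : Type u₁} (h : Bicategory.{v₁, u₂} B) (X : B) :
    MonoidalCategory (X ⟶ X) := inferInstance

/-- `A`-bimodules with the tensor product over `A`. -/
instance bimodMonoidal (A : Mon D) : MonoidalCategory (Bimod A A) :=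
  endMonoidal Bimod.monBicategory A

/-- The bimodules over `A` whose right action is the left action composed with the half-braiding
of `A`. -/
def centralBimodules (A : Mon D) (b : HalfBraiding A.X) : ObjectProperty (Bimod A A) :=
  fun M => (b.β M.X).hom ≫ M.actRight = M.actLeft

theorem centralBimodules_unit (A : Mon D) (b : HalfBraiding A.X)
    (h : (b.β A.X).hom ≫ μ[A.X] = μ[A.X]) : centralBimodules A b (𝟙_ (Bimod A A)) := h

theorem centralBimodules_tensor (A : Mon D) (b : HalfBraiding A.X) {M N : Bimod A A}
    (hM : centralBimodules A b M) (hN : centralBimodules A b N) :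
    centralBimodules A b (M ⊗ N) := by
  unfold centralBimodules at hM hN
  change (b.β _).hom ≫ Bimod.TensorBimod.actRight M N = Bimod.TensorBimod.actLeft M N
  refine (cancel_epi ((tensorLeft A.X).map
    (coequalizer.π (M.actRight ▷ N.X) ((α_ _ _ _).hom ≫ (M.X ◁ N.actLeft))))).1 ?_
  have h2 := Bimod.TensorBimod.π_tensor_id_actRight M N
  have h3 := Bimod.TensorBimod.whiskerLeft_π_actLeft M N
  have h5 : A.X ◁ coequalizer.π (M.actRight ▷ N.X) ((α_ _ _ _).hom ≫ (M.X ◁ N.actLeft)) ≫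
      (b.β (Bimod.TensorBimod.X M N)).hom ≫ Bimod.TensorBimod.actRight M N =
      (b.β (M.X ⊗ N.X)).hom ≫ coequalizer.π _ _ ▷ A.X ≫ Bimod.TensorBimod.actRight M N :=
    b.naturality_assoc _ _
  refine h5.trans (Eq.trans ?_ h3.symm)
  refine (congrArg (fun t => (b.β (M.X ⊗ N.X)).hom ≫ t) h2).trans ?_
  exact halfBraiding_act b hM hN
    (coequalizer.condition (M.actRight ▷ N.X) ((α_ _ _ _).hom ≫ (M.X ◁ N.actLeft)))

end Bimodules

section

variable {D : Type u₁} [Category.{v₁} D] [MonoidalCategory D] [HasCoequalizers D]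
  [RigidCategory D]

/-- The algebra in `D` underlying an algebra in the Drinfeld center of `D`. -/
def centralMon (Z : Center D) [MonObj Z] : Mon D := (Center.forget D).mapMon.obj (Mon.mk Z)

/-- The category of modules in `D` over a (commutative) algebra `Z` in the Drinfeld center of `D`.
A `Z`-module is turned into a bimodule by means of the half-braiding of `Z`, and is recorded
as this bimodule; the right action is determined by the left action. The tensor product is the
tensor product over `Z`, the unit is `Z`, and morphisms are module morphisms. -/
def CentralModules (Z : Center D) [MonObj Z] : Type _ :=
  (centralBimodules (centralMon Z) Z.2).FullSubcategory

instance (Z : Center D) [MonObj Z] : Category.{v₁} (CentralModules Z) :=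
  inferInstanceAs (Category (centralBimodules (centralMon Z) Z.2).FullSubcategory)

instance (Z : Center D) [MonObj Z] [IsCommMonObj Z] :
    (centralBimodules (centralMon Z) Z.2).IsMonoidal where
  prop_unit := by
    refine centralBimodules_unit (centralMon Z) Z.2 ?_
    have h : (β_ Z Z).hom.f ≫ (μ[Z]).f = (μ[Z]).f :=
      congrArg Center.Hom.f (IsCommMonObj.mul_comm Z)
    exact (congrArg (fun t => (Z.2.β Z.1).hom ≫ t) (Category.id_comp (μ[Z]).f)).trans
      (h.trans (Category.id_comp (μ[Z]).f).symm)
  prop_tensor _ _ := centralBimodules_tensor (centralMon Z) Z.2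

instance (Z : Center D) [MonObj Z] [IsCommMonObj Z] : MonoidalCategory (CentralModules Z) :=
  inferInstanceAs (MonoidalCategory (centralBimodules (centralMon Z) Z.2).FullSubcategory)

end

end DeEquivariantization

section Linear

variable {D : Type u₁} [Category.{v₁} D] [MonoidalCategory D] [Preadditive D]
  [MonoidalPreadditive D]

/-- Bimodule morphisms form a subgroup of all morphisms. -/
def bimodHomSubgroup {A B : Mon D} (M N : Bimod A B) : AddSubgroup (M.X ⟶ N.X) where
  carrier := {f | M.actLeft ≫ f = A.X ◁ f ≫ N.actLeft ∧ M.actRight ≫ f = f ▷ B.X ≫ N.actRight}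
  zero_mem' := by simp
  add_mem' ha hb := by
    constructor
    · simp [ha.1, hb.1]
    · simp [ha.2, hb.2]
  neg_mem' {a} ha := by
    have h1 : A.X ◁ (-a) = -(A.X ◁ a) := (tensorLeft A.X).map_neg
    have h2 : (-a) ▷ B.X = -(a ▷ B.X) := (tensorRight B.X).map_neg
    constructor
    · simp [ha.1, h1]
    · simp [ha.2, h2]

/-- Bimodule morphisms are the elements of `bimodHomSubgroup`. -/
def bimodHomEquiv {A B : Mon D} (M N : Bimod A B) : (M ⟶ N) ≃ bimodHomSubgroup M N where
  toFun f := ⟨Bimod.Hom.hom f, Bimod.Hom.left_act_hom f, Bimod.Hom.right_act_hom f⟩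
  invFun f := ⟨f.1, f.2.1, f.2.2⟩

instance {A B : Mon D} (M N : Bimod A B) : AddCommGroup (M ⟶ N) :=
  (bimodHomEquiv M N).addCommGroup

instance (A B : Mon D) : Preadditive (Bimod A B) where
  add_comp U V W f g h := Bimod.hom_ext _ _
    ((Bimod.comp_hom' _ _).trans (Preadditive.add_comp U.X V.X W.X f.hom g.hom h.hom))
  comp_add U V W f g h := Bimod.hom_ext _ _
    ((Bimod.comp_hom' _ _).trans (Preadditive.comp_add U.X V.X W.X f.hom g.hom h.hom))

variable (k : Type u) [Field k] [Linear k D] [MonoidalLinear k D]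

instance {A B : Mon D} (M N : Bimod A B) : SMul k (M ⟶ N) where
  smul c f :=
    { hom := c • Bimod.Hom.hom f
      left_act_hom := by simp
      right_act_hom := by simp }

instance {A B : Mon D} (M N : Bimod A B) : Module k (M ⟶ N) :=
  Function.Injective.module k
    ({ toFun := fun f => Bimod.Hom.hom f
       map_zero' := rfl
       map_add' := fun _ _ => rfl } : (M ⟶ N) →+ (M.X ⟶ N.X))
    (fun _ _ h => Bimod.hom_ext _ _ h) (fun _ _ => rfl)

instance (A B : Mon D) : Linear k (Bimod A B) where
  smul_comp U V W r f g := Bimod.hom_ext _ _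
    ((Bimod.comp_hom' _ _).trans (Linear.smul_comp U.X V.X W.X r f.hom g.hom))
  comp_smul U V W f r g := Bimod.hom_ext _ _
    ((Bimod.comp_hom' _ _).trans (Linear.comp_smul U.X V.X W.X f.hom r g.hom))

variable [HasCoequalizers D] [RigidCategory D] (Z : Center D) [MonObj Z]

instance : Preadditive (CentralModules Z) :=
  inferInstanceAs (Preadditive (centralBimodules (centralMon Z) Z.2).FullSubcategory)

instance : Linear k (CentralModules Z) :=
  inferInstanceAs (Linear k (centralBimodules (centralMon Z) Z.2).FullSubcategory)

end Linear

/-- There is a `k`-linear monoidal equivalence from `C` to `D`. -/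
def TensorEquivalent (k : Type u) [Field k] (C : Type u₁) [Category.{v₁} C] [Preadditive C]
    [Linear k C] [MonoidalCategory C] (D : Type u₂) [Category.{v₂} D] [Preadditive D]
    [Linear k D] [MonoidalCategory D] : Prop :=
  ∃ (F : C ⥤ D) (_ : F.Monoidal), F.IsEquivalence ∧ F.Additive ∧ F.Linear k

/-- A central embedding `rep(G) → D`: a braided functor `lift` from `rep(G)` to the Drinfeld center
of `D` such that the composite with the forgetful functor, which is monoidal, is `k`-linear and
fully faithful. This composite is exact when `rep(G)` is semisimple, in particular in
characteristic zero. -/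
structure CentralEmbedding (k : Type u) [Field k] (G : Type u) [Group G] (D : Type u₁)
    [Category.{v₁} D] [Preadditive D] [Linear k D] [MonoidalCategory D] where
  lift : FDRep k G ⥤ Center D
  braided : lift.Braided
  additive : (lift ⋙ Center.forget D).Additive
  linear : (lift ⋙ Center.forget D).Linear k
  full : (lift ⋙ Center.forget D).Full
  faithful : (lift ⋙ Center.forget D).Faithful

attribute [instance] CentralEmbedding.braided

section

open scoped Obj

variable {k : Type u} [Field k] {G : Type u} [Group G] [Finite G]
  {D : Type u₁} [Category.{v₁} D] [Abelian D] [Linear k D] [MonoidalCategory D]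

/-- The image of `O(G)` in the Drinfeld center of `D` under a central embedding. -/
abbrev CentralEmbedding.algebra (Q : CentralEmbedding k G D) : Center D :=
  Q.lift.obj (functionAlgebra k G)

/-- The de-equivariantization `D_G`: the category of modules over the image of `O(G)` in `D`. -/
abbrev DeEquivariantization [RigidCategory D] (Q : CentralEmbedding k G D) :=
  CentralModules Q.algebra

end

section

variable (k : Type u) [Field k] (G : Type u) [Group G]

/-- `D` is tensor equivalent to `C^G` for some action of `G` on `C`. -/
def IsEquivariantizationOf
    (D : Type u₂) [Category.{v₂} D] [Abelian D] [Linear k D] [MonoidalCategory D]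
    (C : Type u₁) [Category.{v₁} C] [Abelian C] [Linear k C] [MonoidalCategory C]
    [MonoidalPreadditive C] [MonoidalLinear k C] : Prop :=
  ∃ T : TensorAction k G C, TensorEquivalent k D (Equivariantization T)

/-- `C` is tensor equivalent to `D_G` for some central embedding `rep(G) → D`. -/
def IsDeEquivariantizationOf [Finite G]
    (C : Type u₁) [Category.{v₁} C] [Abelian C] [Linear k C] [MonoidalCategory C]
    (D : Type u₂) [Category.{v₂} D] [Abelian D] [Linear k D] [MonoidalCategory D]
    [MonoidalPreadditive D] [MonoidalLinear k D] [RigidCategory D] : Prop :=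
  open scoped Obj in
  ∃ Q : CentralEmbedding k G D, TensorEquivalent k C (DeEquivariantization Q)

end

end FinTensor

end

/-!
Both hypotheses produce the same configuration: a `k`-linear exact functor `F : D ⥤ C` that
preserves the unit object and has an exact right adjoint `I`, and a natural retraction
`π : F ⋙ I ⟶ 𝟭` of the unit of the adjunction. For the equivariantization `D = C^G`, `F` forgets the
equivariant structure, `I` is the induction `W ↦ ⨁ g, ρ(g) W`, and `π` is the average of the
equivariant structure morphisms. For the de-equivariantization `C = D_G`, `F` is the free module
functor `X ↦ O(G) ⊗ X`, `I` forgets the module structure, and `π` is induced by the average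
`O(G) → 𝟙`. Both averages divide by the order of `G`, which is where characteristic zero enters.
Neither case needs `F` to be monoidal.

Such a configuration yields (`finiteType_iff_and_kdim_eq`) an algebra map `φ : A → B` between
`A = Ext(𝟙_D, 𝟙_D)` and `B = Ext(𝟙_C, 𝟙_C)`, isomorphisms `Ext(𝟙_C, W) ≃ Ext(𝟙_D, I W)` of
`A`-modules, and Reynolds operators `Ext(𝟙_C, F V) → Ext(𝟙_D, V)` that are linear over classes from
`D` and retract the maps induced by `F`.

* If `D` is of finite type, the adjunction isomorphisms make every `Ext(𝟙_C, W)`, in particular `B`,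
  a finite `A`-module, so that `C` is of finite type (`finiteType_of_adjunction`).
* If `C` is of finite type, `B` is left Noetherian, because it is graded commutative
  (`ext_unit_comm`) and hence finite over a finitely generated ring of central even classes
  (`exists_finite_over_even`). Hilbert's argument in invariant theory, with the Reynolds operators
  in place of the projection onto invariants, then shows that `D` is of finite type
  (`finiteType_of_reynolds`). It uses that `A` is connected, as `End(𝟙_D) = k`.
* In this case the map between even parts is injective, since it has a retraction, and integral,
  since `B` is finite over `A` and `A` is finite over even classes. So the Krull dimensions agree
  (`krullDim_even_eq`).

Graded commutativity is obtained from the exactness of the tensor product: the interchange law for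
`α ⊗ 𝟙` and `𝟙 ⊗ β` is proved by dimension shifting from the case of two extensions, which is the
sign in the three by three lemma (`extClass_comp_extClass_anticomm`).
-/

universe w' w'' v₃ u₃

noncomputable section

namespace FinTensor

open Abelian

/-! ### Functoriality of Ext and dimension shifting -/

section ExtMap

variable {C : Type u₁} [Category.{v₁} C] [Abelian C] [HasExt.{w} C]

/-- Dimension shifting: every class of positive degree is the class of an extension followed by a
class of smaller degree, so a property of classes follows from its validity for morphisms and its
stability under precomposition with the class of an extension. -/
theorem ext_induction [EnoughProjectives C] {Y : C}
    {P : ∀ {X : C} {n : ℕ}, Ext.{w} X Y n → Prop}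
    (h₀ : ∀ {X : C} (f : X ⟶ Y), P (Ext.mk₀ f))
    (h₁ : ∀ {S : ShortComplex C} (hS : S.ShortExact) {n : ℕ} (y : Ext.{w} S.X₁ Y n), P y →
      P (hS.extClass.comp y (add_comm 1 n)))
    {X : C} {n : ℕ} (x : Ext.{w} X Y n) : P x := by
  induction n generalizing X with
  | zero =>
    obtain ⟨f, rfl⟩ := (Ext.mk₀_bijective X Y).2 x
    exact h₀ f
  | succ n ih =>
    let S := ShortComplex.mk _ _ (kernel.condition (Projective.π X))
    have hS : S.ShortExact := { exact := ShortComplex.exact_of_f_is_kernel _ (kernelIsKernel S.g) }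
    obtain ⟨y, rfl⟩ := Ext.contravariant_sequence_exact₃ hS Y x
      (Ext.eq_zero_of_projective _) (add_comm 1 n)
    exact h₁ hS y (ih y)

/-- Two composable commutative squares of Ext classes paste to a commutative square. -/
theorem comp_comp_of_intertwine {A A' B B' D D' : C} {a : A ⟶ A'} {b : B ⟶ B'} {d : D ⟶ D'}
    {i j c : ℕ}
    {γ : Ext.{w} A B i} {γ' : Ext.{w} A' B' i} {δ : Ext.{w} B D j} {δ' : Ext.{w} B' D' j}
    (hγ : γ.comp (Ext.mk₀ b) (add_zero i) = (Ext.mk₀ a).comp γ' (zero_add i))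
    (hδ : δ.comp (Ext.mk₀ d) (add_zero j) = (Ext.mk₀ b).comp δ' (zero_add j)) (h : i + j = c) :
    (γ.comp δ h).comp (Ext.mk₀ d) (add_zero c) =
      (Ext.mk₀ a).comp (γ'.comp δ' h) (zero_add c) := by
  rw [Ext.comp_assoc_of_third_deg_zero, hδ, ← Ext.comp_assoc_of_second_deg_zero, hγ,
    Ext.comp_assoc]
  omega

variable {D : Type u₂} [Category.{v₂} D] [Abelian D] [HasExt.{w'} D]
variable (F G : C ⥤ D) [F.Additive] [PreservesFiniteLimits F] [PreservesFiniteColimits F]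
  [G.Additive] [PreservesFiniteLimits G] [PreservesFiniteColimits G]

variable {F G} in
/-- A natural transformation between exact functors is natural with respect to Ext classes. -/
theorem mapExactFunctor_natTrans [EnoughProjectives C] (τ : F ⟶ G) {X Y : C} {n : ℕ}
    (x : Ext.{w} X Y n) :
    (x.mapExactFunctor F).comp (Ext.mk₀ (τ.app Y)) (add_zero n) =
      (Ext.mk₀ (τ.app X)).comp (x.mapExactFunctor G) (zero_add n) := by
  induction x using ext_induction with
  | h₀ f => rw [Ext.mapExactFunctor_mk₀, Ext.mapExactFunctor_mk₀, Ext.mk₀_comp_mk₀,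
      Ext.mk₀_comp_mk₀, τ.naturality]
  | @h₁ S hS n y ih =>
    have h := ShortComplex.ShortExact.extClass_naturality (hS.map_of_exact F) (hS.map_of_exact G)
      (S.mapNatTrans τ)
    rw [Ext.mapExactFunctor_comp, Ext.mapExactFunctor_comp, Ext.comp_assoc_of_third_deg_zero, ih,
      Ext.mapExactFunctor_extClass, Ext.mapExactFunctor_extClass]
    refine (Ext.comp_assoc _ _ _ _ _ (by omega)).symm.trans
      ((congrArg (fun t => Ext.comp t _ (add_comm 1 n)) h).trans ?_)
    exact Ext.comp_assoc _ _ _ _ _ (by omega)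

theorem mapExactFunctor_id [EnoughProjectives C] {X Y : C} {n : ℕ} (x : Ext.{w} X Y n) :
    x.mapExactFunctor (𝟭 C) = x := by
  induction x using ext_induction with
  | h₀ f => rw [Ext.mapExactFunctor_mk₀]; rfl
  | @h₁ S hS n y ih =>
    rw [Ext.mapExactFunctor_comp, ih, Ext.mapExactFunctor_extClass]; rfl

theorem mapExactFunctor_mapExactFunctor [EnoughProjectives C]
    {E : Type u₃} [Category.{v₃} E] [Abelian E] [HasExt.{w''} E]
    (H : D ⥤ E) [H.Additive] [PreservesFiniteLimits H] [PreservesFiniteColimits H]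
    {X Y : C} {n : ℕ} (x : Ext.{w} X Y n) :
    (x.mapExactFunctor F).mapExactFunctor H = x.mapExactFunctor (F ⋙ H) := by
  induction x using ext_induction with
  | h₀ f => rw [Ext.mapExactFunctor_mk₀, Ext.mapExactFunctor_mk₀, Ext.mapExactFunctor_mk₀]; rfl
  | @h₁ S hS n y ih =>
    rw [Ext.mapExactFunctor_comp, Ext.mapExactFunctor_comp, Ext.mapExactFunctor_comp, ih,
      Ext.mapExactFunctor_extClass, Ext.mapExactFunctor_extClass]
    exact congrArg (fun t => Ext.comp t _ (add_comm 1 n))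
      (Ext.mapExactFunctor_extClass H (hS.map_of_exact F))

end ExtMap

/-! ### The sign in a three by three diagram -/

section ThreeByThree

variable {C : Type u₁} [Category.{v₁} C] [Abelian C] [HasExt.{w} C]

/-- In a commutative diagram with exact rows `R₁`, `R₂`, `R₃` and exact columns, the two Yoneda
products of border extensions, from the bottom right corner to the top left one, are opposite. -/
theorem extClass_comp_extClass_anticomm {R₁ R₂ R₃ : ShortComplex C} (f : R₁ ⟶ R₂) (g : R₂ ⟶ R₃)
    (hR₁ : R₁.ShortExact) (hR₂ : R₂.ShortExact) (hR₃ : R₃.ShortExact)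
    (w₁ : f.τ₁ ≫ g.τ₁ = 0) (w₂ : f.τ₂ ≫ g.τ₂ = 0) (w₃ : f.τ₃ ≫ g.τ₃ = 0)
    (h₁ : (ShortComplex.mk f.τ₁ g.τ₁ w₁).ShortExact)
    (h₂ : (ShortComplex.mk f.τ₂ g.τ₂ w₂).ShortExact)
    (h₃ : (ShortComplex.mk f.τ₃ g.τ₃ w₃).ShortExact) :
    h₃.extClass.comp hR₁.extClass (rfl : 1 + 1 = 2) =
      -(hR₃.extClass.comp h₁.extClass (rfl : 1 + 1 = 2)) := by
  have := hR₁.mono_f; have := hR₂.mono_f; have := hR₃.mono_f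
  have := hR₁.epi_g; have := hR₂.epi_g; have := hR₃.epi_g
  have : Mono f.τ₁ := h₁.mono_f
  have : Mono f.τ₂ := h₂.mono_f
  have : Mono f.τ₃ := h₃.mono_f
  have : Epi g.τ₁ := h₁.epi_g
  have : Epi g.τ₂ := h₂.epi_g
  have : Epi g.τ₃ := h₃.epi_g
  -- The fibre product `E` of the two epimorphisms onto the bottom right corner is an extension
  -- of this corner by the sum of two corners, and a quotient of the centre by the top left corner.
  obtain ⟨E, p₁, p₂, hE, hp₁⟩ : ∃ (E : C) (p₁ : E ⟶ R₂.X₃) (p₂ : E ⟶ R₃.X₂),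
      IsPullback p₁ p₂ g.τ₃ R₃.g ∧ Epi p₁ :=
    ⟨_, _, _, IsPullback.of_hasPullback g.τ₃ R₃.g, inferInstance⟩
  obtain ⟨i₁, i₁₁, i₁₂⟩ : ∃ i₁ : R₁.X₃ ⟶ E, i₁ ≫ p₁ = f.τ₃ ∧ i₁ ≫ p₂ = 0 :=
    ⟨hE.lift f.τ₃ 0 (by simp [w₃]), by simp, by simp⟩
  obtain ⟨i₂, i₂₁, i₂₂⟩ : ∃ i₂ : R₃.X₁ ⟶ E, i₂ ≫ p₁ = 0 ∧ i₂ ≫ p₂ = R₃.f :=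
    ⟨hE.lift 0 R₃.f (by simp), by simp, by simp⟩
  obtain ⟨q, q₁, q₂⟩ : ∃ q : R₂.X₂ ⟶ E, q ≫ p₁ = R₂.g ∧ q ≫ p₂ = g.τ₂ :=
    ⟨hE.lift R₂.g g.τ₂ g.comm₂₃.symm, by simp, by simp⟩
  have hg₁ : R₁.g ≫ i₁ = f.τ₂ ≫ q := hE.hom_ext (by simp [i₁₁, q₁, f.comm₂₃])
    (by simp [i₁₂, q₂, w₂])
  have hg₂ : g.τ₁ ≫ i₂ = R₂.f ≫ q := hE.hom_ext (by simp [i₂₁, q₁])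
    (by simp [i₂₂, q₂, g.comm₁₂])
  have zS : biprod.desc i₁ i₂ ≫ p₁ ≫ g.τ₃ = 0 := by
    ext <;> simp [reassoc_of% i₁₁, reassoc_of% i₂₁, w₃]
  have zT : (R₁.f ≫ f.τ₂) ≫ q = 0 := by
    rw [Category.assoc, ← hg₁, ShortComplex.zero_assoc, zero_comp]
  have hS : (ShortComplex.mk (biprod.desc i₁ i₂) (p₁ ≫ g.τ₃) zS).ShortExact := by
    have : Mono (biprod.desc i₁ i₂) := by
      refine Preadditive.mono_of_cancel_zero _ fun {Z} t ht => ?_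
      have h1 := congrArg (· ≫ p₁) ht
      have h2 := congrArg (· ≫ p₂) ht
      simp only [biprod.desc_eq, Category.assoc, Preadditive.comp_add, Preadditive.add_comp, i₁₁,
        i₂₁, i₁₂, i₂₂, comp_zero, zero_comp, add_zero, zero_add] at h1 h2
      ext
      · simpa [← cancel_mono f.τ₃] using h1
      · simp [← cancel_mono R₃.f, h2]
    exact
      { exact := ShortComplex.exact_of_f_is_kernel _ <| KernelFork.IsLimit.ofι' _ _
          fun {A} t ht => by
            have ht' : (t ≫ p₂) ≫ R₃.g = 0 := by rw [Category.assoc, ← hE.w, ht]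
            refine ⟨biprod.lift (h₃.exact.lift (t ≫ p₁) (by simpa using ht))
              (hR₃.exact.lift (t ≫ p₂) ht'), hE.hom_ext ?_ ?_⟩
            · have := h₃.exact.lift_f (t ≫ p₁) (by simpa using ht)
              simpa [biprod.desc_eq, i₁₁, i₂₁, biprod.lift_eq] using this
            · simp [biprod.desc_eq, i₁₂, i₂₂, biprod.lift_eq] }
  have hT : (ShortComplex.mk (R₁.f ≫ f.τ₂) q zT).ShortExact := by
    have : Mono (R₁.f ≫ f.τ₂) := mono_comp _ _
    have : Epi q := by
      refine Preadditive.epi_of_cancel_zero _ fun {Z} t ht => ?_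
      have h1 : i₁ ≫ t = 0 := by
        rw [← cancel_epi R₁.g, reassoc_of% hg₁, ht, comp_zero, comp_zero]
      have h2 : i₂ ≫ t = 0 := by
        rw [← cancel_epi g.τ₁, reassoc_of% hg₂, ht, comp_zero, comp_zero]
      have h3 : biprod.desc i₁ i₂ ≫ t = 0 := by ext <;> simp [h1, h2]
      have h4 : (p₁ ≫ g.τ₃) ≫ hS.exact.desc t h3 = t := hS.exact.g_desc t h3
      have h5 : R₂.g ≫ g.τ₃ ≫ hS.exact.desc t h3 = 0 := by
        rw [← q₁, Category.assoc, ← Category.assoc p₁, h4, ht]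
      have h6 : hS.exact.desc t h3 = 0 := by
        rw [← cancel_epi (R₂.g ≫ g.τ₃), Category.assoc, h5, comp_zero]
      rw [← h4, h6, comp_zero]
    exact
      { exact := ShortComplex.exact_of_f_is_kernel _ <| KernelFork.IsLimit.ofι' _ _
          fun {A} t ht => by
            have ht₁ : t ≫ R₂.g = 0 := by rw [← q₁, reassoc_of% ht, zero_comp]
            have ht₂ : t ≫ g.τ₂ = 0 := by rw [← q₂, reassoc_of% ht, zero_comp]
            have h1 : h₂.exact.lift t ht₂ ≫ f.τ₂ = t := h₂.exact.lift_f t ht₂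
            have h2 : h₂.exact.lift t ht₂ ≫ R₁.g = 0 := by
              rw [← cancel_mono f.τ₃, Category.assoc, ← f.comm₂₃, reassoc_of% h1, ht₁, zero_comp]
            refine ⟨hR₁.exact.lift _ h2, ?_⟩
            have h3 : hR₁.exact.lift _ h2 ≫ R₁.f = _ := hR₁.exact.lift_f _ h2
            exact (Category.assoc _ _ _).symm.trans
              ((congrArg (· ≫ f.τ₂) h3).trans h1) }
  let a : R₁ ⟶ ShortComplex.mk (R₁.f ≫ f.τ₂) q zT :=
    { τ₁ := 𝟙 _, τ₂ := f.τ₂, τ₃ := i₁, comm₂₃ := hg₁.symm }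
  let b : ShortComplex.mk f.τ₁ g.τ₁ w₁ ⟶ ShortComplex.mk (R₁.f ≫ f.τ₂) q zT :=
    { τ₁ := 𝟙 _, τ₂ := R₂.f, τ₃ := i₂
      comm₁₂ := by simp [f.comm₁₂]
      comm₂₃ := hg₂.symm }
  let c : ShortComplex.mk (biprod.desc i₁ i₂) (p₁ ≫ g.τ₃) zS ⟶ ShortComplex.mk f.τ₃ g.τ₃ w₃ :=
    { τ₁ := biprod.fst, τ₂ := p₁, τ₃ := 𝟙 _
      comm₁₂ := by ext <;> simp [i₁₁, i₂₁] }
  let d : ShortComplex.mk (biprod.desc i₁ i₂) (p₁ ≫ g.τ₃) zS ⟶ R₃ :=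
    { τ₁ := biprod.snd, τ₂ := p₂, τ₃ := 𝟙 _
      comm₁₂ := by ext <;> simp [i₁₂, i₂₂]
      comm₂₃ := by simp [hE.w] }
  have ha := hR₁.extClass_naturality hT a
  have hb := h₁.extClass_naturality hT b
  have hc := hS.extClass_naturality h₃ c
  have hd := hS.extClass_naturality hR₃ d
  simp only [a, b, c, d, Ext.mk₀_id_comp, Ext.comp_mk₀_id] at ha hb hc hd
  -- The class of `hS` is killed by `biprod.desc i₁ i₂`. Composing with the class of `hT` and
  -- decomposing the identity by the two projections gives the sum of the products in question.
  have h0 := hS.extClass_comp_assoc (h := (rfl : 1 + 1 = 2)) hT.extClass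
  rw [eq_neg_iff_add_eq_zero, ← h0, ha, hb, ← hc, ← hd, Ext.comp_assoc_of_second_deg_zero,
    Ext.comp_assoc_of_second_deg_zero, ← Ext.comp_add]
  congr 1
  rw [Ext.mk₀_comp_mk₀_assoc, Ext.mk₀_comp_mk₀_assoc, ← Ext.add_comp, ← Ext.mk₀_add,
    ← biprod.desc_eq]

end ThreeByThree

/-! ### Graded commutativity of the cohomology of the unit object -/

section Interchange

variable {C : Type u₁} [Category.{v₁} C] [Abelian C] [MonoidalCategory C]
  [MonoidalPreadditive C] [RigidCategory C]

instance preservesFiniteLimits_tensorLeft (X : C) : PreservesFiniteLimits (tensorLeft X) :=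
  have : PreservesLimitsOfSize.{0, 0} (tensorLeft X) :=
    (tensorLeftAdjunction X (Xᘁ)).rightAdjoint_preservesLimits
  PreservesLimitsOfSize.preservesFiniteLimits _

instance preservesFiniteLimits_tensorRight (X : C) : PreservesFiniteLimits (tensorRight X) :=
  have : PreservesLimitsOfSize.{0, 0} (tensorRight X) :=
    (tensorRightAdjunction (ᘁX) X).rightAdjoint_preservesLimits
  PreservesLimitsOfSize.preservesFiniteLimits _

instance preservesFiniteColimits_tensorLeft (X : C) : PreservesFiniteColimits (tensorLeft X) :=
  PreservesColimitsOfSize.preservesFiniteColimits _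

instance preservesFiniteColimits_tensorRight (X : C) : PreservesFiniteColimits (tensorRight X) :=
  PreservesColimitsOfSize.preservesFiniteColimits _

variable [HasExt.{w} C]

/-- Both sides are products of border extensions of the diagram `S ⊗ T`. -/
theorem extClass_tensor_interchange {S T : ShortComplex C} (hS : S.ShortExact)
    (hT : T.ShortExact) :
    ((hS.map_of_exact (tensorRight T.X₃)).extClass).comp
      ((hT.map_of_exact (tensorLeft S.X₁)).extClass) (rfl : 1 + 1 = 2) =
    -(((hT.map_of_exact (tensorLeft S.X₃)).extClass).comp
      ((hS.map_of_exact (tensorRight T.X₁)).extClass) (rfl : 1 + 1 = 2)) :=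
  extClass_comp_extClass_anticomm
    (R₁ := T.map (tensorLeft S.X₁)) (R₂ := T.map (tensorLeft S.X₂))
    (R₃ := T.map (tensorLeft S.X₃))
    (T.mapNatTrans ((curriedTensor C).map S.f)) (T.mapNatTrans ((curriedTensor C).map S.g))
    (hT.map_of_exact (tensorLeft S.X₁)) (hT.map_of_exact (tensorLeft S.X₂))
    (hT.map_of_exact (tensorLeft S.X₃))
    (S.map (tensorRight T.X₁)).zero (S.map (tensorRight T.X₂)).zero (S.map (tensorRight T.X₃)).zero
    (hS.map_of_exact (tensorRight T.X₁)) (hS.map_of_exact (tensorRight T.X₂))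
    (hS.map_of_exact (tensorRight T.X₃))

variable [EnoughProjectives C]

/-- The interchange law for the class of an extension and an arbitrary class. -/
theorem extClass_interchange {S : ShortComplex C} (hS : S.ShortExact) {A B : C} {n : ℕ}
    (β : Ext.{w} A B n) :
    ((hS.map_of_exact (tensorRight A)).extClass).comp
      (β.mapExactFunctor (tensorLeft S.X₁)) (add_comm 1 n) =
    (-1 : ℤ) ^ n • (β.mapExactFunctor (tensorLeft S.X₃)).comp
      ((hS.map_of_exact (tensorRight B)).extClass) rfl := by
  induction β using ext_induction with
  | @h₀ A f =>
    rw [Ext.mapExactFunctor_mk₀, Ext.mapExactFunctor_mk₀, pow_zero, one_smul]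
    exact ShortComplex.ShortExact.extClass_naturality (hS.map_of_exact (tensorRight A))
      (hS.map_of_exact (tensorRight B)) (S.mapNatTrans ((curriedTensor C).flip.map f))
  | @h₁ T hT n β ih =>
    rw [Ext.mapExactFunctor_comp, Ext.mapExactFunctor_comp, Ext.mapExactFunctor_extClass,
      Ext.mapExactFunctor_extClass]
    have h := extClass_tensor_interchange hS hT
    refine (Ext.comp_assoc _ _ _ (rfl : 1 + 1 = 2) _ (by omega)).symm.trans ?_
    refine (congrArg (fun t => Ext.comp t _ (by omega)) h).trans ?_
    refine (Ext.neg_comp _ _ _).trans ?_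
    refine (congrArg Neg.neg (Ext.comp_assoc _ _ _ _ (add_comm 1 n) (by omega))).trans ?_
    refine (congrArg (fun t => -(Ext.comp _ t _)) ih).trans ?_
    refine (congrArg Neg.neg (map_zsmul ((hT.map_of_exact (tensorLeft S.X₃)).extClass.precomp _
      (add_comm 1 (n + 1)))
      _ _)).trans ?_
    rw [pow_succ, mul_neg_one, neg_smul]
    refine congrArg (fun t => -((-1 : ℤ) ^ n • t)) ?_
    exact (Ext.comp_assoc _ _ _ _ _ (by omega)).symm

/-- The two ways of composing `α ⊗ id` and `id ⊗ β` differ by the Koszul sign. -/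
theorem ext_interchange {X X' A B : C} {m n c : ℕ} (α : Ext.{w} X X' m) (β : Ext.{w} A B n)
    (h : m + n = c) (h' : n + m = c) :
    (α.mapExactFunctor (tensorRight A)).comp (β.mapExactFunctor (tensorLeft X')) h =
    (-1 : ℤ) ^ (m * n) • (β.mapExactFunctor (tensorLeft X)).comp
      (α.mapExactFunctor (tensorRight B)) h' := by
  induction α using ext_induction generalizing c with
  | @h₀ X f =>
    obtain rfl : n = c := by omega
    rw [Ext.mapExactFunctor_mk₀, Ext.mapExactFunctor_mk₀, zero_mul, pow_zero, one_smul]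
    exact (mapExactFunctor_natTrans ((curriedTensor C).map f) β).symm
  | @h₁ S hS m α ih =>
    rw [Ext.mapExactFunctor_comp, Ext.mapExactFunctor_comp, Ext.mapExactFunctor_extClass,
      Ext.mapExactFunctor_extClass]
    refine (Ext.comp_assoc _ _ _ _ rfl (by omega)).trans ?_
    refine (congrArg (fun t => Ext.comp _ t (by omega)) (ih rfl (add_comm n m))).trans ?_
    refine (map_zsmul ((hS.map_of_exact (tensorRight A)).extClass.precomp _ (by omega))
      _ _).trans ?_
    rw [add_mul, one_mul, pow_add, mul_smul]
    refine congrArg (fun t => (-1 : ℤ) ^ (m * n) • t) ?_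
    refine (Ext.comp_assoc _ _ _ (add_comm 1 n) (add_comm n m) (by omega)).symm.trans ?_
    refine (congrArg (fun t => Ext.comp t _ (by omega)) (extClass_interchange hS β)).trans ?_
    refine (map_zsmul ((α.mapExactFunctor (tensorRight B)).postcomp _ (by omega))
      _ _).trans ?_
    exact congrArg (fun t => (-1 : ℤ) ^ n • t) (Ext.comp_assoc _ _ _ _ _ (by omega))

/-- The Yoneda algebra of the unit object is graded commutative: left and right tensoring with the
unit are both isomorphic to the identity functor, by isomorphisms that agree at the unit. -/
theorem ext_unit_comm {m n c : ℕ} (α : Ext.{w} (𝟙_ C) (𝟙_ C) m) (β : Ext.{w} (𝟙_ C) (𝟙_ C) n)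
    (h : m + n = c) (h' : n + m = c) :
    α.comp β h = (-1 : ℤ) ^ (m * n) • β.comp α h' := by
  have hl {i : ℕ} (γ : Ext.{w} (𝟙_ C) (𝟙_ C) i) :
      (γ.mapExactFunctor (tensorLeft (𝟙_ C))).comp (Ext.mk₀ (λ_ (𝟙_ C)).hom) (add_zero i) =
        (Ext.mk₀ (λ_ (𝟙_ C)).hom).comp γ (zero_add i) := by
    have h1 := mapExactFunctor_natTrans (leftUnitorNatIso C).hom γ
    rw [mapExactFunctor_id] at h1
    exact h1
  have hr {i : ℕ} (γ : Ext.{w} (𝟙_ C) (𝟙_ C) i) :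
      (γ.mapExactFunctor (tensorRight (𝟙_ C))).comp (Ext.mk₀ (λ_ (𝟙_ C)).hom) (add_zero i) =
        (Ext.mk₀ (λ_ (𝟙_ C)).hom).comp γ (zero_add i) := by
    have h2 := mapExactFunctor_natTrans (rightUnitorNatIso C).hom γ
    have h3 : (rightUnitorNatIso C).hom.app (𝟙_ C) = (λ_ (𝟙_ C)).hom := unitors_equal.symm
    rw [mapExactFunctor_id, h3] at h2
    exact h2
  -- `α` and `β` are identified with `α ⊗ 𝟙` and `𝟙 ⊗ β`, to which the interchange law applies.
  have h1 := comp_comp_of_intertwine (hr α) (hl β) h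
  have h2 := comp_comp_of_intertwine (hl β) (hr α) h'
  have h3 := (congrArg (fun t => Ext.comp t (Ext.mk₀ (λ_ (𝟙_ C)).hom) (add_zero c))
    (ext_interchange α β h h')).trans (map_zsmul ((Ext.mk₀ (λ_ (𝟙_ C)).hom).postcomp _
      (add_zero c)) _ _)
  have h4 := (h1.symm.trans h3).trans (congrArg (fun t => (-1 : ℤ) ^ (m * n) • t) h2)
  have h5 := congrArg (fun t => (Ext.mk₀ (λ_ (𝟙_ C)).inv).comp t (zero_add c)) h4
  refine Eq.trans ?_ (h5.trans ((map_zsmul ((Ext.mk₀ (λ_ (𝟙_ C)).inv).precomp _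
      (zero_add c)) _ _).trans (congrArg (fun t => (-1 : ℤ) ^ (m * n) • t) ?_)))
  · rw [Ext.mk₀_comp_mk₀_assoc, Iso.inv_hom_id, Ext.mk₀_id_comp]
  · change (Ext.mk₀ _).comp ((Ext.mk₀ _).comp _ (zero_add c)) (zero_add c) = _
    rw [Ext.mk₀_comp_mk₀_assoc, Iso.inv_hom_id, Ext.mk₀_id_comp]

end Interchange

/-! ### Superalgebras with central even part -/

section FiniteOverEven

variable (k : Type u) [Field k] {B : Type*} [Ring B] [Algebra k B]

/-- If the even part of a finitely generated superalgebra is central, then the algebra is a finite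
module over a polynomial ring that maps to the even part. The polynomial ring is generated by the
even parts of generators and by the products of two odd parts, and the module by `1` and
the odd parts. -/
theorem exists_finite_over_even [Algebra.FiniteType k B] (E : Subring B) (O : AddSubgroup B)
    (hk : ∀ c : k, algebraMap k B c ∈ E) (hE : ∀ x ∈ E, ∀ y : B, x * y = y * x)
    (hO : ∀ x ∈ O, ∀ y ∈ O, x * y ∈ E) (hEO : ∀ b : B, ∃ x ∈ E, ∃ y ∈ O, b = x + y) :
    ∃ (P : Type u) (_ : CommRing P) (_ : IsNoetherianRing P) (_ : Algebra P B),
      Module.Finite P B ∧ ∀ p : P, algebraMap P B p ∈ E := by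
  classical
  obtain ⟨s, hs⟩ := (inferInstance : Algebra.FiniteType k B).out
  choose ev hev od hod hsum using hEO
  let g : s ⊕ (s × s) → Subalgebra.center k B := Sum.elim
    (fun b => ⟨ev b, Subalgebra.mem_center_iff.2 fun y => (hE _ (hev b) y).symm⟩)
    (fun p => ⟨od p.1 * od p.2,
      Subalgebra.mem_center_iff.2 fun y => (hE _ (hO _ (hod p.1) _ (hod p.2)) y).symm⟩)
  let e : Fin (Fintype.card (s ⊕ (s × s))) ≃ (s ⊕ (s × s)) := (Fintype.equivFin _).symm
  let f : MvPolynomial (Fin (Fintype.card (s ⊕ (s × s)))) k →ₐ[k] Subalgebra.center k B :=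
    MvPolynomial.aeval (g ∘ e)
  let F : MvPolynomial (Fin (Fintype.card (s ⊕ (s × s)))) k →ₐ[k] B :=
    (Subalgebra.center k B).val.comp f
  let alg : Algebra (MvPolynomial (Fin (Fintype.card (s ⊕ (s × s)))) k) B :=
    F.toRingHom.toAlgebra' fun c x => (Subalgebra.mem_center_iff.1 (f c).2 x).symm
  have hF (p) : algebraMap (MvPolynomial (Fin (Fintype.card (s ⊕ (s × s)))) k) B p = F p := rfl
  have hFg (i) : F (MvPolynomial.X (e.symm i)) = g i := by simp [F, f]
  refine ⟨_, inferInstance, inferInstance, alg, ⟨⟨insert 1 (s.image od), ?_⟩⟩, fun p => ?_⟩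
  · set N := Submodule.span (MvPolynomial (Fin (Fintype.card (s ⊕ (s × s)))) k)
      ((insert 1 (s.image od) : Finset B) : Set B) with hN
    have h1 : (1 : B) ∈ N := Submodule.subset_span (by simp)
    have ho (b : s) : od b ∈ N := Submodule.subset_span (by
      simp only [Finset.coe_insert, Finset.coe_image, Set.mem_insert_iff, Set.mem_image]
      exact Or.inr ⟨b, b.2, rfl⟩)
    -- `N` is stable under left multiplication by the generators of the algebra.
    have hmul (b : s) (x : B) (hx : x ∈ N) : (b : B) * x ∈ N := by
      rw [hsum b, add_mul]
      refine add_mem ?_ ?_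
      · have : ev b * x = (MvPolynomial.X (e.symm (Sum.inl b)) :
            MvPolynomial (Fin (Fintype.card (s ⊕ (s × s)))) k) • x := by
          rw [Algebra.smul_def, hF, hFg]; rfl
        rw [this]
        exact N.smul_mem _ hx
      · induction hx using Submodule.span_induction with
        | mem y hy =>
          simp only [Finset.coe_insert, Finset.coe_image, Set.mem_insert_iff,
            Set.mem_image] at hy
          rcases hy with rfl | ⟨c, hc, rfl⟩
          · rw [mul_one]; exact ho b
          · have : od b * od c = (MvPolynomial.X (e.symm (Sum.inr (b, ⟨c, hc⟩))) :
                MvPolynomial (Fin (Fintype.card (s ⊕ (s × s)))) k) • (1 : B) := by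
              rw [Algebra.smul_def, hF, hFg, mul_one]; rfl
            rw [this]
            exact N.smul_mem _ h1
        | zero => rw [mul_zero]; exact zero_mem _
        | add y z _ _ hy hz => rw [mul_add]; exact add_mem hy hz
        | smul p y _ hy => rw [mul_smul_comm]; exact N.smul_mem _ hy
    have hall (b : B) : ∀ x ∈ N, b * x ∈ N := by
      have hb : b ∈ Algebra.adjoin k (s : Set B) := hs ▸ Algebra.mem_top
      induction hb using Algebra.adjoin_induction with
      | mem b hb => exact hmul ⟨b, hb⟩
      | algebraMap r =>
        intro x hx
        have : algebraMap k B r * x =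
            (MvPolynomial.C r : MvPolynomial (Fin (Fintype.card (s ⊕ (s × s)))) k) • x := by
          rw [Algebra.smul_def, hF, ← MvPolynomial.algebraMap_eq, AlgHom.commutes]
        rw [this]
        exact N.smul_mem _ hx
      | add b c _ _ hb hc => intro x hx; rw [add_mul]; exact add_mem (hb x hx) (hc x hx)
      | mul b c _ _ hb hc => intro x hx; rw [mul_assoc]; exact hb _ (hc x hx)
    exact eq_top_iff.2 fun b _ => mul_one b ▸ hall b 1 h1
  · rw [hF]
    induction p using MvPolynomial.induction_on with
    | C r => rw [← MvPolynomial.algebraMap_eq, AlgHom.commutes]; exact hk r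
    | add p q hp hq => rw [map_add]; exact add_mem hp hq
    | mul_X p i hp =>
      rw [map_mul]
      refine mul_mem hp ?_
      obtain ⟨i, rfl⟩ := e.symm.surjective i
      rw [hFg]
      rcases i with b | p
      · exact hev b
      · exact hO _ (hod _) _ (hod _)

theorem isNoetherianRing_of_finite (P : Type*) [CommRing P] [IsNoetherianRing P] [Algebra P B]
    [Module.Finite P B] : IsNoetherianRing B :=
  isNoetherian_of_tower P inferInstance

end FiniteOverEven

/-! ### Finiteness and Reynolds operators -/

section Retraction

variable {A B M N : Type*} [Ring A] [Ring B] [AddCommGroup M] [Module A M]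
  [AddCommGroup N] [Module B N]

theorem finite_compHom_of_surjective (φ : A →+* B) [Module.Finite A M] (σ : M →+ N)
    (hσ : Function.Surjective σ) (h : ∀ (a : A) (m : M), σ (a • m) = φ a • σ m) :
    letI := Module.compHom N φ
    Module.Finite A N := by
  let _ := Module.compHom N φ
  exact Module.Finite.of_surjective ({ σ with map_smul' := h } : M →ₗ[A] N) hσ

theorem finite_of_finite_compHom (φ : A →+* B)
    (h : letI := Module.compHom N φ; Module.Finite A N) : Module.Finite B N := by
  let _ := Module.compHom N φ
  obtain ⟨s, hs⟩ := h.fg_top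
  refine ⟨⟨s, eq_top_iff.2 fun n _ => ?_⟩⟩
  have hn : n ∈ Submodule.span A (s : Set N) := hs ▸ Submodule.mem_top
  induction hn using Submodule.span_induction with
  | mem x hx => exact Submodule.subset_span hx
  | zero => exact zero_mem _
  | add x y _ _ hx hy => exact add_mem (hx trivial) (hy trivial)
  | smul a x _ hx => exact Submodule.smul_mem _ (φ a) (hx trivial)

theorem finiteType_of_finite_compHom (k : Type u) [Field k] [Algebra k A] [Algebra k B]
    [Algebra.FiniteType k A] (φ : A →ₐ[k] B)
    (h : letI := Module.compHom B (φ : A →+* B); Module.Finite A B) : Algebra.FiniteType k B := by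
  classical
  let _ := Module.compHom B (φ : A →+* B)
  obtain ⟨s, hs⟩ := h.fg_top
  obtain ⟨t, ht⟩ := (inferInstance : Algebra.FiniteType k A).out
  refine ⟨⟨s ∪ t.image φ, eq_top_iff.2 fun b _ => ?_⟩⟩
  have hφ (a : A) : φ a ∈ Algebra.adjoin k ((s ∪ t.image φ : Finset B) : Set B) := by
    have : φ a ∈ (Algebra.adjoin k (t : Set A)).map φ := ⟨a, ht ▸ Algebra.mem_top, rfl⟩
    rw [AlgHom.map_adjoin] at this
    exact Algebra.adjoin_mono (by simp) this
  have hb : b ∈ Submodule.span A (s : Set B) := hs ▸ Submodule.mem_top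
  induction hb using Submodule.span_induction with
  | mem x hx => exact Algebra.subset_adjoin (by simp [Finset.mem_coe.1 hx])
  | zero => exact zero_mem _
  | add x y _ _ hx hy => exact add_mem (hx trivial) (hy trivial)
  | smul a x _ hx => exact mul_mem (hφ a) (hx trivial)

/-- In a Noetherian module, the values of a family at the indices satisfying `p` are linear
combinations of finitely many of them. -/
theorem exists_finset_span_image [IsNoetherian B N] {ι : Type*} (f : ι → N) (p : ι → Prop) :
    ∃ t : Finset ι, (∀ i ∈ t, p i) ∧
      ∀ i, p i → ∃ c : t → B, f i = ∑ j, c j • f j := by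
  classical
  have hfg : (Submodule.span B (f '' {i | p i})).FG := IsNoetherian.noetherian _
  obtain ⟨t, ht, hspan⟩ := (Submodule.fg_span_iff_fg_span_finset_subset _).1 hfg
  obtain ⟨t', ht', rfl⟩ := Finset.subset_set_image_iff.1 ht
  refine ⟨t', fun i hi => ht' hi, fun i hi => ?_⟩
  have : f i ∈ Submodule.span B (f '' (t' : Set ι)) := by
    rw [← Finset.coe_image, ← hspan]
    exact Submodule.subset_span ⟨i, hi, rfl⟩
  obtain ⟨c, hc⟩ := (Submodule.mem_span_image_finset_iff_exists_fun B).1 this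
  exact ⟨c, hc.symm⟩

/-- Hilbert's argument for modules: a module over `A` that is a retract, compatibly with
a Reynolds operator `B → A`, of a Noetherian module over `B` is finitely generated. -/
theorem finite_of_retract [IsNoetherian B N] (ι : M →+ N) (R : B → A) (RM : N →+ M)
    (hR : ∀ (b : B) (m : M), RM (b • ι m) = R b • m) (hι : ∀ m, RM (ι m) = m) :
    Module.Finite A M := by
  obtain ⟨t, -, ht⟩ := exists_finset_span_image (B := B) ι fun _ => True
  refine ⟨⟨t, eq_top_iff.2 fun m _ => ?_⟩⟩
  obtain ⟨c, hc⟩ := ht m trivial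
  rw [← hι m, hc, map_sum]
  refine sum_mem fun j hj => ?_
  rw [hR]
  exact Submodule.smul_mem _ _ (Submodule.subset_span j.2)

end Retraction

section GradedRetraction

variable (k : Type u) [Field k] {A : ℕ → Type w} [∀ n, AddCommGroup (A n)]
  [∀ n, Module k (A n)] [DirectSum.GRing A] [DirectSum.GAlgebra k A] {B : Type*} [Ring B]

/-- Hilbert's finiteness argument: a connected graded algebra that is a retract, by a Reynolds
operator, of a left Noetherian ring is finitely generated. -/
theorem finiteType_of_retract [IsNoetherianRing B] (φ : (⨁ n, A n) →+* B) (R : B →+ ⨁ n, A n)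
    (hR : ∀ b a, R (b * φ a) = R b * a) (hφ : ∀ a, R (φ a) = a)
    (h0 : ∀ a : A 0, ∃ c : k, DirectSum.of A 0 a = algebraMap k (⨁ n, A n) c) :
    Algebra.FiniteType k (⨁ n, A n) := by
  classical
  obtain ⟨t, ht0, ht⟩ := exists_finset_span_image (B := B)
    (fun i : (Σ n, A n) => φ (DirectSum.of A i.1 i.2)) fun i => 0 < i.1
  let S := Algebra.adjoin k ((t.image fun i => DirectSum.of A i.1 i.2 : Finset (⨁ n, A n)) :
    Set (⨁ n, A n))
  have hS : ∀ (n : ℕ) (a : A n), DirectSum.of A n a ∈ S := by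
    intro n
    induction n using Nat.strong_induction_on with
    | _ n ih =>
    intro a
    rcases Nat.eq_zero_or_pos n with rfl | hn
    · obtain ⟨c, hc⟩ := h0 a
      rw [hc]
      exact S.algebraMap_mem c
    · obtain ⟨c, hc⟩ := ht ⟨n, a⟩ hn
      -- The Reynolds operator turns an expression of `φ a` through the chosen generators of the
      -- left ideal of positive degree into one with coefficients in `A`.
      have ha : DirectSum.of A n a = ∑ j : t, R (c j) * DirectSum.of A j.1.1 j.1.2 := by
        rw [← hφ (DirectSum.of A n a), hc, map_sum]
        exact Finset.sum_congr rfl fun j _ => hR _ _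
      -- The coefficients need not be homogeneous, so the component of degree `n` is extracted.
      have key (j) (hj : j ∈ t) (r : ⨁ n, A n) :
          DirectSum.of A n ((r * DirectSum.of A j.1 j.2) n) ∈ S := by
        induction r using DirectSum.induction_on with
        | zero => rw [zero_mul, DirectSum.zero_apply, map_zero]; exact zero_mem _
        | of m y =>
          rw [DirectSum.of_mul_of]
          by_cases h : m + j.1 = n
          · subst h
            rw [DirectSum.of_eq_same, ← DirectSum.of_mul_of]
            have := ht0 j hj
            exact mul_mem (ih m (by omega) y)
              (Algebra.subset_adjoin (Finset.mem_coe.2 (Finset.mem_image_of_mem _ hj)))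
          · rw [DirectSum.of_eq_of_ne _ _ _ (Ne.symm h), map_zero]
            exact zero_mem _
        | add x y hx hy =>
          rw [add_mul, DirectSum.add_apply, map_add]
          exact add_mem hx hy
      have hn' : a = (DirectSum.of A n a) n := (DirectSum.of_eq_same n a).symm
      rw [hn', ha, DFinsupp.finsetSum_apply, map_sum]
      exact sum_mem fun j _ => key j j.2 _
  have hS' : S = ⊤ := eq_top_iff.2 fun x _ => by
    induction x using DirectSum.induction_on with
    | zero => exact zero_mem _
    | of m y => exact hS m y
    | add x y hx hy => exact add_mem (hx trivial) (hy trivial)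
  exact ⟨⟨_, hS'⟩⟩

end GradedRetraction

/-! ### Krull dimension of integral extensions -/

section KrullDimension

theorem krullDim_primes (A : Type*) [CommRing A] :
    Order.krullDim {p : Ideal A // p.IsPrime} = Order.krullDim (PrimeSpectrum A) :=
  Order.krullDim_eq_of_orderIso
    { toFun := fun p => ⟨p.1, p.2⟩
      invFun := fun p => ⟨p.1, p.2⟩
      map_rel_iff' := Iff.rfl }

/-- Incomparability bounds the length of chains upstairs, lying over and going up bound the length
of chains downstairs. -/
theorem krullDim_eq_of_isIntegral {A B : Type*} [CommRing A] [CommRing B] (f : A →+* B)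
    (hf : Function.Injective f) (hi : f.IsIntegral) :
    Order.krullDim {p : Ideal A // p.IsPrime} = Order.krullDim {p : Ideal B // p.IsPrime} := by
  let _ := f.toAlgebra
  have : Algebra.IsIntegral A B := ⟨hi⟩
  rw [krullDim_primes, krullDim_primes]
  refine le_antisymm (iSup_le fun l => ?_) (Order.krullDim_le_of_strictMono
    (PrimeSpectrum.comap f) fun p q hpq => Ideal.IsIntegral.comap_lt_comap (R := A) hpq)
  obtain ⟨P, hP⟩ := hi.comap_surjective hf l.head
  have : P.asIdeal.LiesOver l.head.asIdeal := ⟨congrArg PrimeSpectrum.asIdeal hP.symm⟩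
  obtain ⟨L, hL, -⟩ := Ideal.exists_ltSeries_of_hasGoingUp l P.asIdeal
  exact hL ▸ le_iSup (fun p : LTSeries (PrimeSpectrum B) => (p.length : WithBot ℕ∞)) L

/-- A finite injective homomorphism of superalgebras with central even parts, the source being
finite over a ring that maps to its even part, induces an integral extension of
even parts. -/
theorem krullDim_even_eq {A B : Type*} [Ring A] [Ring B] (EA : Subring A) (EB : Subring B)
    (hA : ∀ x ∈ EA, ∀ y : A, x * y = y * x) (hB : ∀ x ∈ EB, ∀ y : B, x * y = y * x)
    (φ : A →+* B) (hφ : Function.Injective φ) (hE : ∀ a ∈ EA, φ a ∈ EB)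
    (P : Type*) [CommRing P] [Algebra P A] [Module.Finite P A] (hP : ∀ p, algebraMap P A p ∈ EA)
    (hfin : letI := Module.compHom B φ; Module.Finite A B) :
    Order.krullDim {p : Ideal EA // p.IsPrime} = Order.krullDim {p : Ideal EB // p.IsPrime} := by
  let _ : CommRing EA := { (inferInstance : Ring EA) with
    mul_comm := fun x y => Subtype.ext (hA x x.2 y) }
  let _ : CommRing EB := { (inferInstance : Ring EB) with
    mul_comm := fun x y => Subtype.ext (hB x x.2 y) }
  let f : EA →+* EB := φ.restrict EA EB hE
  have hf : Function.Injective f := fun x y h =>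
    Subtype.ext (hφ (congrArg Subtype.val h))
  refine krullDim_eq_of_isIntegral f hf fun b => ?_
  let _ := Module.compHom B φ
  let _ : Algebra P B := (φ.comp (algebraMap P A)).toAlgebra' fun p b => hB _ (hE _ (hP p)) b
  have : IsScalarTower P A B := ⟨fun p a b => by
    rw [Algebra.smul_def, Algebra.smul_def]
    change φ (_ * a) * b = φ (algebraMap P A p) * (φ a * b)
    rw [map_mul, mul_assoc]⟩
  have : Module.Finite P B := Module.Finite.trans A B
  obtain ⟨q, hq, hq0⟩ := IsIntegral.of_finite P (b : B)
  let j : P →+* EA := (algebraMap P A).codRestrict EA hP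
  refine ⟨q.map j, hq.map j, Subtype.ext ?_⟩
  have h : (EB.subtype (Polynomial.eval₂ f b (q.map j))) = 0 := by
    rw [Polynomial.eval₂_map, Polynomial.hom_eval₂]
    exact hq0
  exact h

end KrullDimension

/-! ### The even part of the cohomology algebra -/

theorem directSum_induction₂ {A M : ℕ → Type*} [∀ n, AddCommGroup (A n)]
    [∀ n, AddCommGroup (M n)] {P : (⨁ n, A n) → (⨁ n, M n) → Prop}
    (zero_left : ∀ m, P 0 m) (zero_right : ∀ a, P a 0)
    (add_left : ∀ a b m, P a m → P b m → P (a + b) m)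
    (add_right : ∀ a m n, P a m → P a n → P a (m + n))
    (of : ∀ i j (a : A i) (m : M j), P (DirectSum.of A i a) (DirectSum.of M j m))
    (a : ⨁ n, A n) (m : ⨁ n, M n) : P a m := by
  induction a using DirectSum.induction_on with
  | zero => exact zero_left m
  | add a b ha hb => exact add_left a b m ha hb
  | of i a =>
    induction m using DirectSum.induction_on with
    | zero => exact zero_right _
    | add m n hm hn => exact add_right _ m n hm hn
    | of j m => exact of i j a m

section Algebra

variable {C : Type u₁} [Category.{v₁} C] [Abelian C] [HasExt.{w} C]

theorem of_smul_of {X V : C} {i j : ℕ} (a : Ext.{w} X X i) (m : Ext.{w} X V j) :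
    (DirectSum.of (fun n => Ext.{w} X X n) i a • DirectSum.of (fun n => Ext.{w} X V n) j m :
      ExtModule.{w} X V) = DirectSum.of (fun n => Ext.{w} X V n) (i + j) (a.comp m rfl) :=
  DirectSum.Gmodule.of_smul_of _ _ _ _

end Algebra

section EvenPart

variable {C : Type u₁} [Category.{v₁} C] [Abelian C] [MonoidalCategory C]
  [MonoidalPreadditive C] [RigidCategory C] [HasExt.{w} C] [EnoughProjectives C]

theorem of_mul_comm_of_even {i j : ℕ} (hi : Even i) (a : Ext.{w} (𝟙_ C) (𝟙_ C) i)
    (b : Ext.{w} (𝟙_ C) (𝟙_ C) j) :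
    (DirectSum.of (fun n => Ext.{w} (𝟙_ C) (𝟙_ C) n) i a *
      DirectSum.of (fun n => Ext.{w} (𝟙_ C) (𝟙_ C) n) j b : ExtAlgebra.{w} (𝟙_ C)) =
    DirectSum.of (fun n => Ext.{w} (𝟙_ C) (𝟙_ C) n) j b *
      DirectSum.of (fun n => Ext.{w} (𝟙_ C) (𝟙_ C) n) i a := by
  rw [DirectSum.of_mul_of, DirectSum.of_mul_of]
  refine DirectSum.of_eq_of_gradedMonoid_eq ?_
  refine Eq.trans ?_ (gradedMk_comp b a (add_comm j i)).symm
  refine congrArg (GradedMonoid.mk (i + j)) ?_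
  change a.comp b rfl = b.comp a (add_comm j i)
  rw [ext_unit_comm a b rfl (add_comm j i), (hi.mul_right j).neg_one_pow, one_smul]

/-- Even classes commute with all classes, by graded commutativity. -/
theorem evenExt_central (x : ExtAlgebra.{w} (𝟙_ C)) (hx : x ∈ evenExt.{w} (𝟙_ C))
    (y : ExtAlgebra.{w} (𝟙_ C)) : x * y = y * x := by
  classical
  rw [← DirectSum.sum_support_of x, Finset.sum_mul, Finset.mul_sum]
  refine Finset.sum_congr rfl fun i hi => ?_
  have hi' : Even i := by
    rw [← Nat.not_odd_iff_even]
    exact fun h => (DFinsupp.mem_support_iff.1 hi) (hx i h)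
  induction y using DirectSum.induction_on with
  | zero => rw [mul_zero, zero_mul]
  | of j b => exact of_mul_comm_of_even hi' _ _
  | add y z hy hz => rw [mul_add, add_mul, hy, hz]

end EvenPart

section OddPart

variable {C : Type u₁} [Category.{v₁} C] [Abelian C] [HasExt.{w} C]

/-- The elements of `ExtAlgebra X` whose components of even degree vanish. -/
def oddExt (X : C) : AddSubgroup (ExtAlgebra.{w} X) where
  carrier := {x | ∀ n : ℕ, Even n → x n = 0}
  zero_mem' _ _ := rfl
  add_mem' {x y} hx hy n hn := by rw [DirectSum.add_apply, hx n hn, hy n hn, add_zero]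
  neg_mem' {x} hx n hn := by
    have h : (-x) n = -(x n) := DFinsupp.neg_apply x n
    rw [h, hx n hn, neg_zero]

theorem of_mem_evenExt {X : C} {i : ℕ} (hi : Even i) (a : Ext.{w} X X i) :
    DirectSum.of (fun n => Ext.{w} X X n) i a ∈ evenExt.{w} X := fun _ hn =>
  DirectSum.of_eq_of_ne _ _ _ fun h => (Nat.not_odd_iff_even.2 hi) (h ▸ hn)

theorem mul_mem_evenExt {X : C} (x : ExtAlgebra.{w} X) (hx : x ∈ oddExt X)
    (y : ExtAlgebra.{w} X) (hy : y ∈ oddExt X) : x * y ∈ evenExt.{w} X := by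
  classical
  rw [DirectSum.mul_eq_sum_support_ghas_mul]
  refine sum_mem fun ij hij => ?_
  rw [Finset.mem_product, DFinsupp.mem_support_iff, DFinsupp.mem_support_iff] at hij
  have h1 : Odd ij.1 := Nat.not_even_iff_odd.1 fun h => hij.1 (hx _ h)
  have h2 : Odd ij.2 := Nat.not_even_iff_odd.1 fun h => hij.2 (hy _ h)
  exact of_mem_evenExt (h1.add_odd h2) _

theorem exists_even_add_odd {X : C} (b : ExtAlgebra.{w} X) :
    ∃ x ∈ evenExt.{w} X, ∃ y ∈ oddExt X, b = x + y := by
  induction b using DirectSum.induction_on with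
  | zero => exact ⟨0, zero_mem _, 0, zero_mem _, (add_zero 0).symm⟩
  | of i a =>
    rcases Nat.even_or_odd i with hi | hi
    · exact ⟨_, of_mem_evenExt hi a, 0, zero_mem _, (add_zero _).symm⟩
    · refine ⟨0, zero_mem _, _, fun n hn => ?_, (zero_add _).symm⟩
      exact DirectSum.of_eq_of_ne _ _ _ fun h => (Nat.not_odd_iff_even.2 hn) (h ▸ hi)
  | add x y hx hy =>
    obtain ⟨a, ha, b, hb, rfl⟩ := hx
    obtain ⟨c, hc, d, hd, rfl⟩ := hy
    exact ⟨a + c, add_mem ha hc, b + d, add_mem hb hd, add_add_add_comm _ _ _ _⟩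

variable (k : Type u) [Field k] [Linear k C]

theorem algebraMap_mem_evenExt (X : C) (c : k) :
    algebraMap k (ExtAlgebra.{w} X) c ∈ evenExt.{w} X :=
  of_mem_evenExt (Even.zero) (Ext.mk₀ (c • 𝟙 X))

variable [MonoidalCategory C] [MonoidalPreadditive C] [RigidCategory C] [EnoughProjectives C]

/-- A finitely generated cohomology algebra is finite over a commutative Noetherian ring of
even classes. -/
theorem exists_finite_over_evenExt [Algebra.FiniteType k (ExtAlgebra.{w} (𝟙_ C))] :
    ∃ (P : Type u) (_ : CommRing P) (_ : IsNoetherianRing P)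
      (_ : Algebra P (ExtAlgebra.{w} (𝟙_ C))), Module.Finite P (ExtAlgebra.{w} (𝟙_ C)) ∧
        ∀ p : P, algebraMap P (ExtAlgebra.{w} (𝟙_ C)) p ∈ evenExt.{w} (𝟙_ C) :=
  exists_finite_over_even k (evenExt.{w} (𝟙_ C)) (oddExt.{w} (𝟙_ C))
    (algebraMap_mem_evenExt k _) evenExt_central mul_mem_evenExt exists_even_add_odd

end OddPart

/-! ### Cohomology and adjunctions -/

section Transfer

variable {C : Type u₁} [Category.{v₁} C] [Abelian C] [HasExt.{w} C]
  {D : Type u₂} [Category.{v₂} D] [Abelian D] [HasExt.{w'} D]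

section

variable (F : D ⥤ C) [F.Additive] [PreservesFiniteLimits F] [PreservesFiniteColimits F]
  {X : D} {Y : C} (e : F.obj X ≅ Y)

/-- The map `Ext(X, V) → Ext(Y, F V)` induced by `F` and an isomorphism `F X ≅ Y`. -/
def extMap (V : D) (n : ℕ) : Ext.{w'} X V n →+ Ext.{w} Y (F.obj V) n :=
  ((Ext.mk₀ e.inv).precomp _ (zero_add n)).comp (F.mapExtAddHom X V n)

theorem extMap_apply {V : D} {n : ℕ} (m : Ext.{w'} X V n) :
    extMap F e V n m = (Ext.mk₀ e.inv).comp (m.mapExactFunctor F) (zero_add n) := rfl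

/-- The map `Ext(X, X) → Ext(Y, Y)` induced by `F` and an isomorphism `F X ≅ Y`. -/
def extEndMap (n : ℕ) : Ext.{w'} X X n →+ Ext.{w} Y Y n :=
  ((Ext.mk₀ e.hom).postcomp _ (add_zero n)).comp (extMap F e X n)

theorem extEndMap_apply {n : ℕ} (a : Ext.{w'} X X n) :
    extEndMap F e n a = (extMap F e X n a).comp (Ext.mk₀ e.hom) (add_zero n) := rfl

theorem extMap_comp {V : D} {i j n : ℕ} (a : Ext.{w'} X X i) (m : Ext.{w'} X V j)
    (h : i + j = n) :
    extMap F e V n (a.comp m h) = (extEndMap F e i a).comp (extMap F e V j m) h := by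
  rw [extEndMap_apply, extMap_apply, extMap_apply, extMap_apply, Ext.comp_assoc_of_second_deg_zero,
    Ext.mk₀_comp_mk₀_assoc, Iso.hom_inv_id, Ext.mk₀_id_comp, Ext.mapExactFunctor_comp,
    Ext.comp_assoc]
  omega

theorem extEndMap_comp {i j n : ℕ} (a : Ext.{w'} X X i) (b : Ext.{w'} X X j) (h : i + j = n) :
    extEndMap F e n (a.comp b h) = (extEndMap F e i a).comp (extEndMap F e j b) h := by
  rw [extEndMap_apply, extMap_comp, Ext.comp_assoc_of_third_deg_zero, ← extEndMap_apply]

variable (k : Type u) [Field k] [Linear k C] [Linear k D] [F.Linear k]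

theorem extEndMap_mk₀_smul (c : k) :
    extEndMap F e 0 (Ext.mk₀ (c • 𝟙 X) : Ext.{w'} X X 0) = (Ext.mk₀ (c • 𝟙 Y) : Ext.{w} Y Y 0) := by
  rw [extEndMap_apply, extMap_apply, Ext.mapExactFunctor_mk₀, Ext.mk₀_comp_mk₀, Ext.mk₀_comp_mk₀]
  simp

/-- The algebra homomorphism `Ext(X, X) → Ext(Y, Y)` induced by `F` and an isomorphism `F X ≅ Y`. -/
def extAlgebraMap : ExtAlgebra.{w'} X →ₐ[k] ExtAlgebra.{w} Y where
  toFun := DirectSum.map (extEndMap F e)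
  map_zero' := map_zero _
  map_add' := map_add _
  map_one' := by
    refine (DirectSum.map_of _ 0 _).trans (congrArg (DirectSum.of _ 0) ?_)
    have := extEndMap_mk₀_smul.{w} F e k 1
    rwa [one_smul, one_smul] at this
  map_mul' a b := by
    induction a, b using directSum_induction₂ with
    | zero_left m => rw [zero_mul, map_zero, zero_mul]
    | zero_right m => rw [mul_zero, map_zero, mul_zero]
    | add_left a b m ha hb => rw [add_mul, map_add, ha, hb, map_add, add_mul]
    | add_right a b m ha hb => rw [mul_add, map_add, ha, hb, map_add, mul_add]
    | of i j a b =>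
      rw [DirectSum.map_of, DirectSum.map_of, DirectSum.of_mul_of, DirectSum.of_mul_of,
        DirectSum.map_of]
      exact congrArg _ (extEndMap_comp F e a b rfl)
  commutes' c := (DirectSum.map_of _ 0 _).trans
    (congrArg (DirectSum.of _ 0) (extEndMap_mk₀_smul F e k c))

theorem extAlgebraMap_mem_evenExt (a : ExtAlgebra.{w'} X) (ha : a ∈ evenExt.{w'} X) :
    extAlgebraMap.{w} F e k a ∈ evenExt.{w} Y := fun n hn => by
  have : extAlgebraMap.{w} F e k a n = extEndMap F e n (a n) := DirectSum.map_apply _ _ _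
  rw [this, ha n hn, map_zero]

end

section

variable {F : D ⥤ C} [F.Additive] [PreservesFiniteLimits F] [PreservesFiniteColimits F]
  {I : C ⥤ D} [I.Additive] [PreservesFiniteLimits I] [PreservesFiniteColimits I]
  (adj : F ⊣ I) {X : D} {Y : C} (e : F.obj X ≅ Y)

/-- The map `Ext(Y, W) → Ext(X, I W)` given by an adjunction `F ⊣ I` and an isomorphism
`F X ≅ Y`. -/
def extAdj (W : C) (n : ℕ) : Ext.{w} Y W n →+ Ext.{w'} X (I.obj W) n :=
  ((Ext.mk₀ (adj.unit.app X ≫ I.map e.hom)).precomp _ (zero_add n)).comp (I.mapExtAddHom Y W n)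

omit [F.Additive] [PreservesFiniteLimits F] [PreservesFiniteColimits F] in
theorem extAdj_apply {W : C} {n : ℕ} (b : Ext.{w} Y W n) :
    extAdj adj e W n b =
      (Ext.mk₀ (adj.unit.app X ≫ I.map e.hom)).comp (b.mapExactFunctor I) (zero_add n) := rfl

/-- The map `Ext(X, I W) → Ext(Y, W)` given by an adjunction `F ⊣ I` and an isomorphism
`F X ≅ Y`; it is inverse to `extAdj`. -/
def extAdjInv (W : C) (n : ℕ) : Ext.{w'} X (I.obj W) n →+ Ext.{w} Y W n :=
  ((Ext.mk₀ (adj.counit.app W)).postcomp _ (add_zero n)).comp (extMap F e (I.obj W) n)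

omit [I.Additive] [PreservesFiniteLimits I] [PreservesFiniteColimits I] in
theorem extAdjInv_apply {W : C} {n : ℕ} (y : Ext.{w'} X (I.obj W) n) :
    extAdjInv adj e W n y =
      (extMap.{w} F e (I.obj W) n y).comp (Ext.mk₀ (adj.counit.app W)) (add_zero n) := rfl

theorem extAdjInv_extAdj [EnoughProjectives C] {W : C} {n : ℕ} (b : Ext.{w} Y W n) :
    extAdjInv adj e W n (extAdj adj e W n b) = b := by
  have h := mapExactFunctor_natTrans adj.counit b
  have h2 : (b.mapExactFunctor I : Ext.{w'} _ _ n).mapExactFunctor F = _ :=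
    mapExactFunctor_mapExactFunctor I F b
  rw [mapExactFunctor_id, ← h2] at h
  rw [extAdjInv_apply, extAdj_apply, extMap_apply, Ext.mapExactFunctor_comp,
    Ext.mapExactFunctor_mk₀, Ext.mk₀_comp_mk₀_assoc, Ext.comp_assoc_of_third_deg_zero]
  refine (congrArg (fun t => Ext.comp _ t _) h).trans ?_
  rw [Ext.mk₀_comp_mk₀_assoc]
  have h1 : (e.inv ≫ F.map (adj.unit.app X ≫ I.map e.hom)) ≫ adj.counit.app Y = 𝟙 Y := by
    simp
  exact (congrArg (fun t => Ext.comp (Ext.mk₀ t) b (zero_add n)) h1).trans (Ext.mk₀_id_comp b)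

omit [I.Additive] [PreservesFiniteLimits I] [PreservesFiniteColimits I] in
/-- The adjunction isomorphism is linear over `Ext(X, X)`. -/
theorem extAdjInv_comp {W : C} {i j n : ℕ} (a : Ext.{w'} X X i) (y : Ext.{w'} X (I.obj W) j)
    (h : i + j = n) :
    extAdjInv adj e W n (a.comp y h) =
      (extEndMap F e i a).comp (extAdjInv adj e W j y) h := by
  rw [extAdjInv_apply, extAdjInv_apply, extMap_comp, Ext.comp_assoc_of_third_deg_zero]

variable (π : F ⋙ I ⟶ 𝟭 D)

/-- The Reynolds operator `Ext(Y, F V) → Ext(X, V)` given by an adjunction `F ⊣ I`,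
an isomorphism `F X ≅ Y` and a retraction `π` of the unit. -/
def extReynolds (V : D) (n : ℕ) : Ext.{w} Y (F.obj V) n →+ Ext.{w'} X V n :=
  ((Ext.mk₀ (π.app V)).postcomp _ (add_zero n)).comp (extAdj adj e (F.obj V) n)

omit [F.Additive] [PreservesFiniteLimits F] [PreservesFiniteColimits F] in
theorem extReynolds_apply {V : D} {n : ℕ} (b : Ext.{w} Y (F.obj V) n) :
    extReynolds adj e π V n b =
      (extAdj adj e (F.obj V) n b).comp (Ext.mk₀ (π.app V)) (add_zero n) := rfl

/-- The Reynolds operator `Ext(Y, Y) → Ext(X, X)`. -/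
def extEndReynolds (n : ℕ) : Ext.{w} Y Y n →+ Ext.{w'} X X n :=
  (extReynolds adj e π X n).comp ((Ext.mk₀ e.inv).postcomp _ (add_zero n))

omit [F.Additive] [PreservesFiniteLimits F] [PreservesFiniteColimits F] in
theorem extEndReynolds_apply {n : ℕ} (b : Ext.{w} Y Y n) :
    extEndReynolds adj e π n b =
      extReynolds adj e π X n (b.comp (Ext.mk₀ e.inv) (add_zero n)) := rfl

variable [EnoughProjectives D]

/-- The projection formula: the Reynolds operator is linear over classes that come from `D`. -/
theorem extReynolds_comp {V : D} {i j n : ℕ} (b : Ext.{w} Y Y i) (m : Ext.{w'} X V j)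
    (h : i + j = n) :
    extReynolds adj e π V n (b.comp (extMap F e V j m) h) =
      (extEndReynolds adj e π i b).comp m h := by
  have hm := mapExactFunctor_natTrans π m
  have h2 : (m.mapExactFunctor F : Ext.{w} _ _ j).mapExactFunctor I = _ :=
    mapExactFunctor_mapExactFunctor F I m
  rw [mapExactFunctor_id, ← h2] at hm
  rw [extEndReynolds_apply, extReynolds_apply, extReynolds_apply, extAdj_apply, extAdj_apply,
    extMap_apply, ← Ext.comp_assoc_of_second_deg_zero, Ext.mapExactFunctor_comp]
  generalize (Ext.mapExactFunctor I (b.comp (Ext.mk₀ e.inv) (add_zero i))) = c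
  rw [← Ext.comp_assoc (a₁₂ := i) (a₂₃ := n) _ _ _ (zero_add i) h (by omega),
    Ext.comp_assoc_of_third_deg_zero, Ext.comp_assoc_of_second_deg_zero]
  exact congrArg (fun t => Ext.comp _ t h) hm

variable (hπ : ∀ V, adj.unit.app V ≫ π.app V = 𝟙 V)

include hπ in
theorem extReynolds_extMap {V : D} {n : ℕ} (m : Ext.{w'} X V n) :
    extReynolds adj e π V n (extMap F e V n m) = m := by
  have h := extReynolds_comp adj e π (Ext.mk₀ (𝟙 Y)) m (zero_add n)
  rw [Ext.mk₀_id_comp] at h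
  rw [h, extEndReynolds_apply, extReynolds_apply, extAdj_apply, Ext.mk₀_id_comp,
    Ext.mapExactFunctor_mk₀, Ext.mk₀_comp_mk₀]
  have h1 : (adj.unit.app X ≫ I.map e.hom) ≫ I.map e.inv = adj.unit.app X := by
    simp
  rw [h1]
  have h2 := Ext.mk₀_comp_mk₀ (adj.unit.app X) (π.app X)
  rw [hπ] at h2
  exact (congrArg (fun t => Ext.comp t m (zero_add n)) h2).trans (Ext.mk₀_id_comp m)

theorem extEndReynolds_comp {i j n : ℕ} (b : Ext.{w} Y Y i) (a : Ext.{w'} X X j)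
    (h : i + j = n) :
    extEndReynolds adj e π n (b.comp (extEndMap F e j a) h) =
      (extEndReynolds adj e π i b).comp a h := by
  rw [← extReynolds_comp, extEndReynolds_apply, extEndMap_apply, Ext.comp_assoc_of_third_deg_zero,
    Ext.comp_assoc_of_third_deg_zero, Ext.mk₀_comp_mk₀, Iso.hom_inv_id, Ext.comp_mk₀_id]

include hπ in
theorem extEndReynolds_extEndMap {n : ℕ} (a : Ext.{w'} X X n) :
    extEndReynolds adj e π n (extEndMap F e n a) = a := by
  rw [extEndReynolds_apply, extEndMap_apply, Ext.comp_assoc_of_third_deg_zero, Ext.mk₀_comp_mk₀,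
    Iso.hom_inv_id, Ext.comp_mk₀_id, extReynolds_extMap adj e π hπ]

variable (k : Type u) [Field k] [Linear k C] [Linear k D] [F.Linear k]

omit [EnoughProjectives D] [I.Additive] [PreservesFiniteLimits I] [PreservesFiniteColimits I] in
theorem extAdjInv_smul {W : C} (a : ExtAlgebra.{w'} X) (y : ExtModule.{w'} X (I.obj W)) :
    DirectSum.map (extAdjInv adj e W) (a • y) =
      (extAlgebraMap.{w} F e k a • DirectSum.map (extAdjInv adj e W) y :
        ExtModule.{w} Y W) := by
  induction a, y using directSum_induction₂ with
  | zero_left m => rw [zero_smul, map_zero, map_zero, zero_smul]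
  | zero_right m => rw [smul_zero, map_zero, smul_zero]
  | add_left a b m ha hb => rw [add_smul, map_add, ha, hb, map_add, add_smul]
  | add_right a b m ha hb => rw [smul_add, map_add, ha, hb, map_add, smul_add]
  | of i j a b =>
    have : extAlgebraMap.{w} F e k (DirectSum.of _ i a) = DirectSum.of _ i (extEndMap F e i a) :=
      DirectSum.map_of _ _ _
    rw [this, DirectSum.map_of, of_smul_of, of_smul_of, DirectSum.map_of, extAdjInv_comp]

omit [EnoughProjectives D] in
theorem extAdjInv_surjective [EnoughProjectives C] (W : C) :
    Function.Surjective (DirectSum.map (extAdjInv adj e W)) := fun b =>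
  ⟨DirectSum.map (extAdj adj e W) b, by
    induction b using DirectSum.induction_on with
    | zero => rw [map_zero, map_zero]
    | of i b => rw [DirectSum.map_of, DirectSum.map_of, extAdjInv_extAdj]
    | add x y hx hy => rw [map_add, map_add, hx, hy]⟩

theorem extReynolds_smul {V : D} (b : ExtAlgebra.{w} Y) (m : ExtModule.{w'} X V) :
    DirectSum.map (extReynolds adj e π V)
      (b • DirectSum.map (extMap.{w} F e V) m : ExtModule.{w} Y (F.obj V)) =
      (DirectSum.map (extEndReynolds adj e π) b • m : ExtModule.{w'} X V) := by
  induction b, m using directSum_induction₂ with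
  | zero_left m => rw [zero_smul, map_zero, map_zero, zero_smul]
  | zero_right m => rw [map_zero, smul_zero, map_zero, smul_zero]
  | add_left a b m ha hb => rw [add_smul, map_add, ha, hb, map_add, add_smul]
  | add_right a b m ha hb => rw [map_add, smul_add, map_add, ha, hb, smul_add]
  | of i j a b =>
    rw [DirectSum.map_of, DirectSum.map_of, of_smul_of, of_smul_of, DirectSum.map_of,
      extReynolds_comp]

include hπ in
theorem extReynolds_extModuleMap {V : D} (m : ExtModule.{w'} X V) :
    DirectSum.map (extReynolds adj e π V) (DirectSum.map (extMap.{w} F e V) m) = m := by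
  induction m using DirectSum.induction_on with
  | zero => rw [map_zero, map_zero]
  | of i b => rw [DirectSum.map_of, DirectSum.map_of, extReynolds_extMap adj e π hπ]
  | add x y hx hy => rw [map_add, map_add, hx, hy]

theorem extEndReynolds_mul (b : ExtAlgebra.{w} Y) (a : ExtAlgebra.{w'} X) :
    DirectSum.map (extEndReynolds adj e π) (b * extAlgebraMap.{w} F e k a) =
      DirectSum.map (extEndReynolds adj e π) b * a := by
  induction b, a using directSum_induction₂ with
  | zero_left m => rw [zero_mul, map_zero, zero_mul]
  | zero_right m => rw [map_zero, mul_zero, map_zero, mul_zero]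
  | add_left a b m ha hb => rw [add_mul, map_add, ha, hb, map_add, add_mul]
  | add_right a b m ha hb => rw [map_add, mul_add, map_add, ha, hb, mul_add]
  | of i j a b =>
    have : extAlgebraMap.{w} F e k (DirectSum.of _ j b) = DirectSum.of _ j (extEndMap F e j b) :=
      DirectSum.map_of _ _ _
    rw [this, DirectSum.map_of, DirectSum.of_mul_of, DirectSum.of_mul_of, DirectSum.map_of]
    exact congrArg _ (extEndReynolds_comp adj e π a b rfl)

include hπ in
theorem extEndReynolds_extAlgebraMap (a : ExtAlgebra.{w'} X) :
    DirectSum.map (extEndReynolds adj e π) (extAlgebraMap.{w} F e k a) = a := by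
  induction a using DirectSum.induction_on with
  | zero => rw [map_zero, map_zero]
  | of i b =>
    have : extAlgebraMap.{w} F e k (DirectSum.of _ i b) = DirectSum.of _ i (extEndMap F e i b) :=
      DirectSum.map_of _ _ _
    rw [this, DirectSum.map_of, extEndReynolds_extEndMap adj e π hπ]
  | add x y hx hy => rw [map_add, map_add, hx, hy]

end

end Transfer

/-! ### Transfer of finite generation and Krull dimension -/

section FiniteType

variable {C : Type u₁} [Category.{v₁} C] [Abelian C] [HasExt.{w} C] [EnoughProjectives C]
  [MonoidalCategory C] [MonoidalPreadditive C] [RigidCategory C]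
  {D : Type u₂} [Category.{v₂} D] [Abelian D] [HasExt.{w'} D] [EnoughProjectives D]
  [MonoidalCategory D] [MonoidalPreadditive D] [RigidCategory D]
  {F : D ⥤ C} [F.Additive] [PreservesFiniteLimits F] [PreservesFiniteColimits F]
  {I : C ⥤ D} [I.Additive] [PreservesFiniteLimits I] [PreservesFiniteColimits I]
  (adj : F ⊣ I) (e : F.obj (𝟙_ D) ≅ 𝟙_ C) (π : F ⋙ I ⟶ 𝟭 D)
  (hπ : ∀ V, adj.unit.app V ≫ π.app V = 𝟙 V)
  (k : Type u) [Field k] [Linear k C] [Linear k D] [F.Linear k]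

include adj in
omit [EnoughProjectives D] [MonoidalPreadditive C] [MonoidalPreadditive D] [RigidCategory C]
  [RigidCategory D] in
/-- As a module over `Ext(𝟙_D, 𝟙_D)`, `Ext(𝟙_C, W)` is isomorphic to `Ext(𝟙_D, I W)`. -/
theorem finite_extAlgebraMap
    (hD : ∀ V : D, Module.Finite (ExtAlgebra.{w'} (𝟙_ D)) (ExtModule.{w'} (𝟙_ D) V)) (W : C) :
    letI := Module.compHom (ExtModule.{w} (𝟙_ C) W)
      (extAlgebraMap F e k : ExtAlgebra.{w'} (𝟙_ D) →+* ExtAlgebra.{w} (𝟙_ C))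
    Module.Finite (ExtAlgebra.{w'} (𝟙_ D)) (ExtModule.{w} (𝟙_ C) W) :=
  have := hD (I.obj W)
  finite_compHom_of_surjective _ (DirectSum.map (extAdjInv adj e W))
    (extAdjInv_surjective adj e W) (extAdjInv_smul adj e k)

include adj e in
omit [EnoughProjectives D] [MonoidalPreadditive C] [MonoidalPreadditive D] [RigidCategory C]
  [RigidCategory D] in
/-- Finite type descends along the algebra map from the cohomology of `D` to that of `C`, which is
finite. -/
theorem finiteType_of_adjunction
    (h : Algebra.FiniteType k (ExtAlgebra.{w'} (𝟙_ D)))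
    (hD : ∀ V : D, Module.Finite (ExtAlgebra.{w'} (𝟙_ D)) (ExtModule.{w'} (𝟙_ D) V)) :
    Algebra.FiniteType k (ExtAlgebra.{w} (𝟙_ C)) ∧
      ∀ W : C, Module.Finite (ExtAlgebra.{w} (𝟙_ C)) (ExtModule.{w} (𝟙_ C) W) :=
  ⟨finiteType_of_finite_compHom k (extAlgebraMap F e k)
    (finite_extAlgebraMap adj e k hD (𝟙_ C)), fun W =>
    finite_of_finite_compHom _ (finite_extAlgebraMap adj e k hD W)⟩

include hπ e in
omit [MonoidalPreadditive D] [RigidCategory D] in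
/-- The cohomology of `C` is Noetherian, so Hilbert's argument with the Reynolds operator applies to
the cohomology of `D`. -/
theorem finiteType_of_reynolds
    (hend : ∀ f : 𝟙_ D ⟶ 𝟙_ D, ∃ c : k, f = c • 𝟙 (𝟙_ D))
    (h : Algebra.FiniteType k (ExtAlgebra.{w} (𝟙_ C)))
    (hC : ∀ W : C, Module.Finite (ExtAlgebra.{w} (𝟙_ C)) (ExtModule.{w} (𝟙_ C) W)) :
    Algebra.FiniteType k (ExtAlgebra.{w'} (𝟙_ D)) ∧
      ∀ V : D, Module.Finite (ExtAlgebra.{w'} (𝟙_ D)) (ExtModule.{w'} (𝟙_ D) V) := by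
  obtain ⟨P, _, _, _, hP, -⟩ := exists_finite_over_evenExt.{w} (C := C) k
  have : IsNoetherianRing (ExtAlgebra.{w} (𝟙_ C)) := isNoetherianRing_of_finite P
  refine ⟨finiteType_of_retract k
    (extAlgebraMap F e k : ExtAlgebra.{w'} (𝟙_ D) →+* ExtAlgebra.{w} (𝟙_ C))
    (DirectSum.map (extEndReynolds adj e π)) (extEndReynolds_mul adj e π k)
    (extEndReynolds_extAlgebraMap adj e π hπ k) fun a => ?_, fun V => ?_⟩
  · obtain ⟨f, rfl⟩ := (Ext.mk₀_bijective _ _).2 a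
    obtain ⟨c, rfl⟩ := hend f
    exact ⟨c, rfl⟩
  · have := hC (F.obj V)
    exact finite_of_retract (B := ExtAlgebra.{w} (𝟙_ C))
      (DirectSum.map (extMap F e V)) (DirectSum.map (extEndReynolds adj e π))
      (DirectSum.map (extReynolds adj e π V)) (extReynolds_smul adj e π)
      (extReynolds_extModuleMap adj e π hπ)

include hπ e in
/-- The map of even parts is injective, thanks to the Reynolds operator, and integral. -/
theorem krullDim_evenExt_eq
    (h : Algebra.FiniteType k (ExtAlgebra.{w'} (𝟙_ D)))
    (hD : ∀ V : D, Module.Finite (ExtAlgebra.{w'} (𝟙_ D)) (ExtModule.{w'} (𝟙_ D) V)) :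
    Order.krullDim {p : Ideal (evenExt.{w'} (𝟙_ D)) // p.IsPrime} =
      Order.krullDim {p : Ideal (evenExt.{w} (𝟙_ C)) // p.IsPrime} := by
  obtain ⟨P, _, _, _, hP, hPE⟩ := exists_finite_over_evenExt.{w'} (C := D) k
  exact krullDim_even_eq _ _ evenExt_central evenExt_central
    (extAlgebraMap F e k : ExtAlgebra.{w'} (𝟙_ D) →+* ExtAlgebra.{w} (𝟙_ C))
    (Function.LeftInverse.injective (extEndReynolds_extAlgebraMap adj e π hπ k))
    (extAlgebraMap_mem_evenExt F e k) P hPE (finite_extAlgebraMap adj e k hD (𝟙_ C))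

end FiniteType

/-- Finite type and Krull dimension are shared by two finite tensor categories connected by an
exact functor that preserves the unit object and has an exact right adjoint, provided that
the unit of the adjunction has a natural retraction. -/
theorem finiteType_iff_and_kdim_eq (k : Type u) [Field k]
    {C : Type u₁} [Category.{v₁} C] [Abelian C] [Linear k C]
    [MonoidalCategory C] [MonoidalPreadditive C] [MonoidalLinear k C] [RigidCategory C]
    {D : Type u₂} [Category.{v₂} D] [Abelian D] [Linear k D]
    [MonoidalCategory D] [MonoidalPreadditive D] [MonoidalLinear k D] [RigidCategory D]
    (hC : IsFiniteTensorCategory k C) (hD : IsFiniteTensorCategory k D)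
    {F : D ⥤ C} [F.Additive] [PreservesFiniteLimits F] [PreservesFiniteColimits F] [F.Linear k]
    {I : C ⥤ D} [I.Additive] [PreservesFiniteLimits I] [PreservesFiniteColimits I]
    (adj : F ⊣ I) (e : F.obj (𝟙_ D) ≅ 𝟙_ C) (π : F ⋙ I ⟶ 𝟭 D)
    (hπ : ∀ V, adj.unit.app V ≫ π.app V = 𝟙 V) :
    (IsOfFiniteType k D ↔ IsOfFiniteType k C) ∧ (IsOfFiniteType k C → Kdim D = Kdim C) := by
  have := hC.enoughProjectives
  have := hD.enoughProjectives
  have : HasExt.{max u₁ v₁} C := HasExt.standard C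
  have : HasExt.{max u₂ v₂} D := HasExt.standard D
  have h₁ : IsOfFiniteType k D → IsOfFiniteType k C := fun h =>
    finiteType_of_adjunction adj e k h.1 h.2
  have h₂ : IsOfFiniteType k C → IsOfFiniteType k D := fun h =>
    finiteType_of_reynolds adj e π hπ k hD.end_unit h.1 h.2
  exact ⟨⟨h₁, h₂⟩, fun h =>
    krullDim_evenExt_eq adj e π hπ k (h₂ h).1 (h₂ h).2⟩

/-! ### Exactness of adjoint functors -/

section Exactness

variable {A : Type u₁} [Category.{v₁} A] [Abelian A] {B : Type u₂} [Category.{v₂} B] [Abelian B]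
  {F : A ⥤ B} {I : B ⥤ A}

theorem preservesFiniteLimits_of_leftAdjoint (adj : F ⊣ I) [F.Additive]
    [F.PreservesMonomorphisms] : PreservesFiniteLimits F := by
  have : PreservesColimitsOfSize.{0, 0} F := adj.leftAdjoint_preservesColimits
  have := F.preservesHomology_of_preservesMonos_and_cokernels
  exact F.preservesFiniteLimits_of_preservesHomology

theorem preservesFiniteColimits_of_rightAdjoint (adj : F ⊣ I) [I.Additive]
    [I.PreservesEpimorphisms] : PreservesFiniteColimits I := by
  have : PreservesLimitsOfSize.{0, 0} I := adj.rightAdjoint_preservesLimits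
  have := I.preservesHomology_of_preservesEpis_and_kernels
  exact I.preservesFiniteColimits_of_preservesHomology

end Exactness

/-- A left adjoint is right exact and a right adjoint is left exact, so that the exactness of both
functors amounts to the preservation of monomorphisms, respectively of epimorphisms. -/
theorem finiteType_iff_and_kdim_eq_of_adjunction (k : Type u) [Field k]
    {C : Type u₁} [Category.{v₁} C] [Abelian C] [Linear k C]
    [MonoidalCategory C] [MonoidalPreadditive C] [MonoidalLinear k C] [RigidCategory C]
    {D : Type u₂} [Category.{v₂} D] [Abelian D] [Linear k D]
    [MonoidalCategory D] [MonoidalPreadditive D] [MonoidalLinear k D] [RigidCategory D]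
    (hC : IsFiniteTensorCategory k C) (hD : IsFiniteTensorCategory k D)
    {F : D ⥤ C} [F.Additive] [F.Linear k] [F.PreservesMonomorphisms]
    {I : C ⥤ D} [I.PreservesEpimorphisms]
    (adj : F ⊣ I) (e : F.obj (𝟙_ D) ≅ 𝟙_ C) (π : F ⋙ I ⟶ 𝟭 D)
    (hπ : ∀ V, adj.unit.app V ≫ π.app V = 𝟙 V) :
    (IsOfFiniteType k D ↔ IsOfFiniteType k C) ∧ (IsOfFiniteType k C → Kdim D = Kdim C) := by
  have := adj.right_adjoint_additive
  have := preservesFiniteLimits_of_leftAdjoint adj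
  have := preservesFiniteColimits_of_rightAdjoint adj
  have : PreservesColimitsOfSize.{0, 0} F := adj.leftAdjoint_preservesColimits
  have : PreservesLimitsOfSize.{0, 0} I := adj.rightAdjoint_preservesLimits
  have : PreservesFiniteColimits F := PreservesColimitsOfSize0.preservesFiniteColimits F
  have : PreservesFiniteLimits I := PreservesLimitsOfSize0.preservesFiniteLimits I
  exact finiteType_iff_and_kdim_eq k hC hD adj e π hπ

/-! ### Transport of adjunctions with a retraction along equivalences -/

section Transport

variable {A : Type u₁} [Category.{v₁} A] {B : Type u₂} [Category.{v₂} B] {X : Type u₃}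
  [Category.{v₃} X] (E : B ≌ X) {U : X ⥤ A} {I : A ⥤ X}

/-- The transport of a natural transformation `U ⋙ I ⟶ 𝟭` along an equivalence of the source of `U`
with another category. -/
def precompRetraction (π : U ⋙ I ⟶ 𝟭 X) : (E.functor ⋙ U) ⋙ (I ⋙ E.inverse) ⟶ 𝟭 B where
  app V := E.inverse.map (π.app (E.functor.obj V)) ≫ E.unitInv.app V
  naturality V W f := by
    have h := π.naturality (E.functor.map f)
    dsimp only [Functor.comp_map, Functor.id_map, Functor.comp_obj, Functor.id_obj] at h ⊢
    rw [← Functor.map_comp_assoc, h, Functor.map_comp_assoc, Category.assoc]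
    exact congrArg (_ ≫ ·) (E.unitInv.naturality f)

theorem comp_precompRetraction (adj : U ⊣ I) (π : U ⋙ I ⟶ 𝟭 X)
    (hπ : ∀ V, adj.unit.app V ≫ π.app V = 𝟙 V) (V : B) :
    (E.toAdjunction.comp adj).unit.app V ≫ (precompRetraction E π).app V = 𝟙 V := by
  have h := (E.inverse.map_comp _ _).symm.trans
    ((congrArg E.inverse.map (hπ (E.functor.obj V))).trans (E.inverse.map_id _))
  rw [Adjunction.comp_unit_app, Category.assoc, precompRetraction]
  refine (congrArg (_ ≫ ·) ((reassoc_of% h) _)).trans ?_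
  exact E.unitIso.hom_inv_id_app V

end Transport

section Transport

variable {A : Type u₁} [Category.{v₁} A] {B : Type u₂} [Category.{v₂} B] {X : Type u₃}
  [Category.{v₃} X] (E : A ≌ X) {F : B ⥤ X} {U : X ⥤ B}

/-- The transport of a natural transformation `F ⋙ U ⟶ 𝟭` along an equivalence between the target
of `F` and another category. -/
def postcompRetraction (π : F ⋙ U ⟶ 𝟭 B) : (F ⋙ E.inverse) ⋙ (E.functor ⋙ U) ⟶ 𝟭 B where
  app V := U.map (E.counit.app (F.obj V)) ≫ π.app V
  naturality V W f := by
    have h := π.naturality f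
    dsimp only [Functor.comp_map, Functor.id_map, Functor.comp_obj, Functor.id_obj] at h ⊢
    rw [Category.assoc, ← h, ← Functor.map_comp_assoc, ← Functor.map_comp_assoc]
    exact congrArg (fun t => U.map t ≫ _) (E.counit.naturality (F.map f))

theorem comp_postcompRetraction (adj : F ⊣ U) (π : F ⋙ U ⟶ 𝟭 B)
    (hπ : ∀ V, adj.unit.app V ≫ π.app V = 𝟙 V) (V : B) :
    (adj.comp E.symm.toAdjunction).unit.app V ≫ (postcompRetraction E π).app V = 𝟙 V := by
  have h : U.map (E.counitInv.app (F.obj V)) ≫ U.map (E.counit.app (F.obj V)) = 𝟙 _ :=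
    (U.map_comp _ _).symm.trans ((congrArg U.map
      (E.counitIso.inv_hom_id_app (F.obj V))).trans (U.map_id _))
  rw [Adjunction.comp_unit_app, Category.assoc, postcompRetraction]
  exact (congrArg (_ ≫ ·) ((reassoc_of% h) _)).trans (hπ V)

end Transport

/-! ### Equivariant objects -/

namespace TensorAction

variable {k : Type u} [Field k] {G : Type u} [Group G] {C : Type u₁} [Category.{v₁} C]
  [Preadditive C] [Linear k C] [MonoidalCategory C] (T : TensorAction k G C)

/-- The component at `X` of the isomorphism `ρ(g) ρ(h) ≅ ρ(m)`, where `g * h = m`. -/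
def mulApp {g h m : G} (e : g * h = m) (X : C) :
    (T.act g).obj ((T.act h).obj X) ≅ (T.act m).obj X :=
  (T.mulIso e).app X

/-- The component at `X` of the isomorphism `id ≅ ρ(1)`. -/
def oneApp (X : C) : X ≅ (T.act 1).obj X := T.oneIso.app X

theorem mulApp_naturality {g h m : G} (e : g * h = m) {X Y : C} (f : X ⟶ Y) :
    (T.act g).map ((T.act h).map f) ≫ (T.mulApp e Y).hom =
      (T.mulApp e X).hom ≫ (T.act m).map f :=
  (T.mulIso e).hom.naturality f

theorem mulApp_inv_naturality {g h m : G} (e : g * h = m) {X Y : C} (f : X ⟶ Y) :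
    (T.act m).map f ≫ (T.mulApp e Y).inv =
      (T.mulApp e X).inv ≫ (T.act g).map ((T.act h).map f) :=
  (T.mulIso e).inv.naturality f

theorem oneApp_naturality {X Y : C} (f : X ⟶ Y) :
    f ≫ (T.oneApp Y).hom = (T.oneApp X).hom ≫ (T.act 1).map f :=
  T.oneIso.hom.naturality f

theorem mulApp_assoc {g h l a b c : G} (e₁ : g * h = a) (e₂ : h * l = b) (e₃ : a * l = c)
    (e₄ : g * b = c) (X : C) : (T.mulApp e₁ ((T.act l).obj X)).hom ≫ (T.mulApp e₃ X).hom =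
      (T.act g).map (T.mulApp e₂ X).hom ≫ (T.mulApp e₄ X).hom :=
  T.assoc e₁ e₂ e₃ e₄ X

theorem oneApp_mulApp (g : G) (X : C) :
    (T.oneApp ((T.act g).obj X)).hom ≫ (T.mulApp (one_mul g) X).hom = 𝟙 _ :=
  T.one_left g X

theorem mulApp_mul_one_inv (g : G) (X : C) :
    (T.mulApp (mul_one g) X).inv = (T.act g).map (T.oneApp X).hom :=
  (Iso.comp_hom_eq_id _).1 (T.one_right g X) |>.symm

/-- The functor of `g` is an equivalence with inverse the functor of `g⁻¹`. -/
def actEquivalence (g : G) : C ≌ C :=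
  CategoryTheory.Equivalence.mk (T.act g) (T.act g⁻¹)
    (T.oneIso ≪≫ (T.mulIso (inv_mul_cancel g)).symm)
    (T.mulIso (mul_inv_cancel g) ≪≫ T.oneIso.symm)

instance (g : G) : (T.act g).IsEquivalence := (T.actEquivalence g).isEquivalence_functor

end TensorAction

namespace Equivariantization

section

variable {k : Type u} [Field k] {G : Type u} [Group G] {C : Type u₁} [Category.{v₁} C]
  [Preadditive C] [Linear k C] [MonoidalCategory C] {T : TensorAction k G C}

theorem mulApp_comp_iso (V : Equivariantization T) {g h m : G} (e : g * h = m) :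
    (T.mulApp e V.obj).hom ≫ (V.iso m).hom = (T.act g).map (V.iso h).hom ≫ (V.iso g).hom := by
  subst e
  exact V.comp g h

/-- The unit constraint follows from the composition law, since the morphism `u 1` is invertible. -/
theorem oneApp_comp_iso (V : Equivariantization T) :
    (T.oneApp V.obj).hom ≫ (V.iso 1).hom = 𝟙 V.obj := by
  rw [← cancel_epi (V.iso 1).hom, Category.comp_id, reassoc_of% @T.oneApp_naturality,
    ← V.mulApp_comp_iso (one_mul 1), reassoc_of% T.oneApp_mulApp]

/-- An equivariant structure given by morphisms `v g : ρ(g) V ⟶ V` of which only `v 1` is assumed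
to be invertible; the other ones are invertible by the composition law. -/
def ofHom (V : C) (v : ∀ g : G, (T.act g).obj V ⟶ V)
    (comp : ∀ {g h m : G} (e : g * h = m),
      (T.mulApp e V).hom ≫ v m = (T.act g).map (v h) ≫ v g)
    (one : (T.oneApp V).hom ≫ v 1 = 𝟙 V) : Equivariantization T where
  obj := V
  iso g :=
    { hom := v g
      inv := (T.oneApp V).hom ≫ (T.mulApp (mul_inv_cancel g) V).inv ≫ (T.act g).map (v g⁻¹)
      hom_inv_id := by
        have a := T.mulApp_assoc (mul_inv_cancel g) (inv_mul_cancel g) (one_mul g) (mul_one g) V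
        replace a := (Iso.inv_comp_eq _).2 (((Iso.comp_inv_eq _).2 a).symm.trans
          (Category.assoc _ _ _))
        rw [reassoc_of% @T.oneApp_naturality, reassoc_of% @T.mulApp_inv_naturality,
          ← Functor.map_comp, ← comp (inv_mul_cancel g), Functor.map_comp, reassoc_of% a,
          reassoc_of% T.oneApp_mulApp,
          T.mulApp_mul_one_inv, ← Functor.map_comp, one, CategoryTheory.Functor.map_id]
      inv_hom_id := by
        rw [Category.assoc, Category.assoc, ← comp (mul_inv_cancel g), Iso.inv_hom_id_assoc,
          one] }
  comp g h := comp rfl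

variable (T) in
/-- The functor `C^G ⥤ C` that forgets equivariant structures. -/
@[simps]
def forget : Equivariantization T ⥤ C where
  obj V := V.obj
  map f := Hom.hom f

instance : (forget T).Faithful where
  map_injective h := Hom.ext h

instance : (forget T).Additive where

instance : (forget T).Linear k where

end

section

variable {k : Type u} [Field k] {G : Type u} [Group G] {C : Type u₁} [Category.{v₁} C]
  [Abelian C] [Linear k C] [MonoidalCategory C] {T : TensorAction k G C}

/-- The kernel of a morphism of `C^G` inherits an equivariant structure. -/
def kernelObj {V W : Equivariantization T} (f : V ⟶ W) : Equivariantization T :=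
  ofHom (kernel (Hom.hom f))
    (fun g => kernel.lift _ ((T.act g).map (kernel.ι (Hom.hom f)) ≫ (V.iso g).hom) (by
      rw [Category.assoc, Hom.comm f, ← Functor.map_comp_assoc, kernel.condition]; simp))
    (fun {g h m} e => by
      rw [← cancel_mono (kernel.ι (Hom.hom f))]
      simp only [Category.assoc, kernel.lift_ι]
      rw [← reassoc_of% @T.mulApp_naturality, V.mulApp_comp_iso e, ← Functor.map_comp_assoc,
        ← Functor.map_comp_assoc, kernel.lift_ι])
    (by
      rw [← cancel_mono (kernel.ι (Hom.hom f)), Category.assoc, kernel.lift_ι,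
        ← reassoc_of% @T.oneApp_naturality, V.oneApp_comp_iso, Category.comp_id, Category.id_comp])

/-- If `f` is a monomorphism of `C^G`, the inclusion of its kernel in `C`, being equivariant, is
zero. -/
instance : (forget T).PreservesMonomorphisms where
  preserves {V W} f hf := by
    refine Preadditive.mono_of_kernel_zero ?_
    let κ : kernelObj f ⟶ V := ⟨kernel.ι (Hom.hom f), fun g => kernel.lift_ι _ _ _⟩
    have h : κ ≫ f = 0 := Hom.ext (kernel.condition (Hom.hom f))
    have h' : κ = 0 := by rw [← cancel_mono f, h, zero_comp]
    exact congrArg Hom.hom h'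

/-! ### Induction and averaging -/

variable [Finite G]

attribute [local instance] Abelian.hasFiniteBiproducts

/-- The morphism `ρ(h) (⨁ g, ρ(g) W) ⟶ ⨁ g, ρ(g) W` that identifies `ρ(h) ρ(g)` with `ρ(hg)`. -/
def inducedHom (T : TensorAction k G C) (W : C) (h : G) :
    (T.act h).obj (⨁ fun g : G => (T.act g).obj W) ⟶ ⨁ fun g : G => (T.act g).obj W :=
  biproduct.lift fun m => (T.act h).map (biproduct.π _ (h⁻¹ * m)) ≫
    (T.mulApp (mul_inv_cancel_left h m) W).hom

theorem inducedHom_π (W : C) {h g m : G} (e : h * g = m) :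
    inducedHom T W h ≫ biproduct.π _ m =
      (T.act h).map (biproduct.π _ g) ≫ (T.mulApp e W).hom := by
  obtain rfl : g = h⁻¹ * m := eq_inv_mul_of_mul_eq e
  exact biproduct.lift_π _ _

/-- The induced object `⨁ g, ρ(g) W` of `C^G`, on which `G` permutes the summands. -/
def induced (T : TensorAction k G C) (W : C) : Equivariantization T :=
  ofHom (⨁ fun g : G => (T.act g).obj W) (inducedHom T W)
    (fun {a b c} e => by
      refine biproduct.hom_ext _ _ fun m => ?_
      have h : b * (c⁻¹ * m) = a⁻¹ * m := by subst e; group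
      rw [Category.assoc, Category.assoc, inducedHom_π W (mul_inv_cancel_left c m),
        inducedHom_π W (mul_inv_cancel_left a m), ← reassoc_of% @T.mulApp_naturality,
        T.mulApp_assoc e h (mul_inv_cancel_left c m) (mul_inv_cancel_left a m),
        ← Functor.map_comp_assoc, ← Functor.map_comp_assoc, inducedHom_π W h])
    (by
      refine biproduct.hom_ext _ _ fun m => ?_
      rw [Category.assoc, inducedHom_π W (one_mul m), ← reassoc_of% @T.oneApp_naturality,
        T.oneApp_mulApp, Category.comp_id, Category.id_comp])

/-- The projection of the induced object onto a summand. -/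
def inducedπ (T : TensorAction k G C) (W : C) (g : G) :
    (induced T W).obj ⟶ (T.act g).obj W :=
  biproduct.π (fun g : G => (T.act g).obj W) g

/-- The morphism to the induced object with given components. -/
def inducedLift {X W : C} (f : ∀ g : G, X ⟶ (T.act g).obj W) : X ⟶ (induced T W).obj :=
  biproduct.lift f

theorem inducedLift_π {X W : C} (f : ∀ g : G, X ⟶ (T.act g).obj W) (g : G) :
    inducedLift f ≫ inducedπ T W g = f g :=
  biproduct.lift_π _ _

theorem induced_hom_ext {X W : C} {f f' : X ⟶ (induced T W).obj}
    (h : ∀ g : G, f ≫ inducedπ T W g = f' ≫ inducedπ T W g) : f = f' :=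
  biproduct.hom_ext _ _ h

theorem induced_iso_π (W : C) {h g m : G} (e : h * g = m) :
    ((induced T W).iso h).hom ≫ inducedπ T W m =
      (T.act h).map (inducedπ T W g) ≫ (T.mulApp e W).hom :=
  inducedHom_π W e

/-- The morphism of induced objects given by `ρ(g)(f)` on the summand of `g`. -/
def inducedMap (T : TensorAction k G C) {V W : C} (f : V ⟶ W) :
    (induced T V).obj ⟶ (induced T W).obj :=
  inducedLift fun g => inducedπ T V g ≫ (T.act g).map f

theorem inducedMap_π {V W : C} (f : V ⟶ W) (g : G) :
    inducedMap T f ≫ inducedπ T W g = inducedπ T V g ≫ (T.act g).map f :=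
  inducedLift_π _ _

theorem inducedMap_comp {V W X : C} (f : V ⟶ W) (f' : W ⟶ X) :
    inducedMap T (f ≫ f') = inducedMap T f ≫ inducedMap T f' :=
  induced_hom_ext fun g => by
    rw [Category.assoc, inducedMap_π, inducedMap_π, reassoc_of% @inducedMap_π, Functor.map_comp]

theorem inducedMap_id (W : C) : inducedMap T (𝟙 W) = 𝟙 (induced T W).obj :=
  induced_hom_ext fun g => by
    rw [inducedMap_π, CategoryTheory.Functor.map_id, Category.comp_id, Category.id_comp]

/-- Induction, the functor `W ↦ ⨁ g, ρ(g) W` from `C` to `C^G`. -/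
def induction (T : TensorAction k G C) : C ⥤ Equivariantization T where
  obj W := induced T W
  map {V W} f := ⟨inducedMap T f, fun h => induced_hom_ext fun m => by
    rw [Category.assoc, Category.assoc, inducedMap_π,
      induced_iso_π W (mul_inv_cancel_left h m),
      reassoc_of% induced_iso_π (T := T) V (mul_inv_cancel_left h m),
      ← T.mulApp_naturality, ← Functor.map_comp_assoc, ← Functor.map_comp_assoc, inducedMap_π]⟩
  map_id W := Hom.ext (inducedMap_id W)
  map_comp f g := Hom.ext (inducedMap_comp f g)

/-- The functors `ρ(g)` are equivalences, and the forgetful functor is faithful. -/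
instance : (induction T).PreservesEpimorphisms where
  preserves {V W} f hf := by
    have : Epi ((forget T).map ((induction T).map f)) :=
      inferInstanceAs (Epi (biproduct.map fun g => (T.act g).map f))
    exact (forget T).epi_of_epi_map this

/-- The equivariant morphism `V ⟶ ⨁ g, ρ(g) W` with components `ρ(g)(f) ∘ (u g)⁻¹`. -/
def toInduced {V : Equivariantization T} {W : C} (f : V.obj ⟶ W) : V ⟶ induced T W :=
  ⟨inducedLift fun g => (V.iso g).inv ≫ (T.act g).map f, fun h => by
    refine induced_hom_ext fun m => ?_
    have c := V.mulApp_comp_iso (mul_inv_cancel_left h m)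
    rw [Category.assoc, Category.assoc, inducedLift_π,
      induced_iso_π W (mul_inv_cancel_left h m), ← Functor.map_comp_assoc, inducedLift_π,
      Functor.map_comp, Category.assoc, T.mulApp_naturality, ← Category.assoc, ← Category.assoc]
    congr 1
    rw [Iso.comp_inv_eq, Category.assoc, c, ← Functor.map_comp_assoc, Iso.inv_hom_id,
      CategoryTheory.Functor.map_id, Category.id_comp]⟩

/-- An equivariant morphism to an induced object is determined by its component at `1`. -/
theorem hom_inducedπ {V : Equivariantization T} {W : C} (φ : V ⟶ induced T W) (g : G) :
    Hom.hom φ ≫ inducedπ T W g = (V.iso g).inv ≫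
      (T.act g).map (Hom.hom φ ≫ inducedπ T W 1) ≫ (T.mulApp (mul_one g) W).hom := by
  rw [Iso.eq_inv_comp, ← Category.assoc, Hom.comm φ g, Category.assoc,
    induced_iso_π W (mul_one g), ← Functor.map_comp_assoc]

theorem ext_induced {V : Equivariantization T} {W : C} {φ ψ : V ⟶ induced T W}
    (h : Hom.hom φ ≫ inducedπ T W 1 = Hom.hom ψ ≫ inducedπ T W 1) : φ = ψ :=
  Hom.ext (induced_hom_ext fun g => by rw [hom_inducedπ φ, hom_inducedπ ψ, h])

theorem toInduced_π_one {V : Equivariantization T} {W : C} (f : V.obj ⟶ W) :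
    Hom.hom (toInduced f) ≫ inducedπ T W 1 = f ≫ (T.oneApp W).hom := by
  refine (inducedLift_π _ _).trans ?_
  rw [Iso.inv_comp_eq, T.oneApp_naturality, ← Category.assoc,
    (Iso.hom_comp_eq_id _).1 V.oneApp_comp_iso, Iso.inv_hom_id, Category.id_comp]

/-- Equivariant morphisms to an induced object are the morphisms of `C` to the summand of `1`. -/
def toInducedEquiv (V : Equivariantization T) (W : C) : (V.obj ⟶ W) ≃ (V ⟶ induced T W) where
  toFun := toInduced
  invFun φ := Hom.hom φ ≫ inducedπ T W 1 ≫ (T.oneApp W).inv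
  left_inv f := by
    dsimp only
    rw [← Category.assoc, Iso.comp_inv_eq, toInduced_π_one]
  right_inv φ := ext_induced (by
    dsimp only
    rw [toInduced_π_one, Category.assoc, Category.assoc, Iso.inv_hom_id, Category.comp_id])

theorem toInduced_comp {V : Equivariantization T} {W X : C} (f : V.obj ⟶ W) (f' : W ⟶ X) :
    toInduced (f ≫ f') = toInduced f ≫ (induction T).map f' :=
  ext_induced (by
    change _ = (Hom.hom (toInduced f) ≫ inducedMap T f') ≫ _
    rw [Category.assoc, inducedMap_π, ← Category.assoc, toInduced_π_one, toInduced_π_one,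
      Category.assoc, Category.assoc, T.oneApp_naturality])

variable (T) in
/-- Induction is right adjoint to the forgetful functor. -/
def forgetAdjInduction : forget T ⊣ induction T :=
  Adjunction.mkOfHomEquiv
    { homEquiv := toInducedEquiv
      homEquiv_naturality_left_symm _ _ := Category.assoc _ _ _
      homEquiv_naturality_right := toInduced_comp }

theorem forgetAdjInduction_unit_π (V : Equivariantization T) (g : G) :
    Hom.hom ((forgetAdjInduction T).unit.app V) ≫ inducedπ T V.obj g = (V.iso g).inv := by
  refine (inducedLift_π _ _).trans ?_
  exact (congrArg (_ ≫ ·) ((T.act g).map_id V.obj)).trans (Category.comp_id _)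

end

section Averaging

variable {k : Type u} [Field k] {G : Type u} [Group G] [Fintype G] {C : Type u₁} [Category.{v₁} C]
  [Abelian C] [Linear k C] [MonoidalCategory C] {T : TensorAction k G C}

/-- The average over `G` of the morphisms `u g : ρ(g) V ⟶ V`. -/
def average (V : Equivariantization T) : (induced T V.obj).obj ⟶ V.obj :=
  (Fintype.card G : k)⁻¹ • ∑ g : G, inducedπ T V.obj g ≫ (V.iso g).hom

theorem average_comm (V : Equivariantization T) (h : G) :
    ((induced T V.obj).iso h).hom ≫ average V = (T.act h).map (average V) ≫ (V.iso h).hom := by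
  rw [average, Linear.comp_smul, Functor.map_smul, Linear.smul_comp, Preadditive.comp_sum,
    Functor.map_sum, Preadditive.sum_comp]
  congr 1
  refine (Fintype.sum_equiv (Equiv.mulLeft h) _ _ fun g => ?_).symm
  rw [Equiv.coe_mulLeft, reassoc_of% induced_iso_π (T := T) V.obj (rfl : h * g = h * g),
    V.mulApp_comp_iso, Functor.map_comp_assoc]

theorem average_naturality {V W : Equivariantization T} (f : V ⟶ W) :
    inducedMap T (Hom.hom f) ≫ average W = average V ≫ Hom.hom f := by
  rw [average, average, Linear.comp_smul, Linear.smul_comp, Preadditive.comp_sum,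
    Preadditive.sum_comp]
  simp only [reassoc_of% @inducedMap_π, Category.assoc, Hom.comm]

theorem comp_average [CharZero k] (V : Equivariantization T)
    (f : V.obj ⟶ (induced T V.obj).obj) (hf : ∀ g : G, f ≫ inducedπ T V.obj g = (V.iso g).inv) :
    f ≫ average V = 𝟙 V.obj := by
  rw [average, Linear.comp_smul, Preadditive.comp_sum]
  simp only [reassoc_of% hf, Iso.inv_hom_id]
  rw [Finset.sum_const, Finset.card_univ, ← Nat.cast_smul_eq_nsmul k, smul_smul,
    inv_mul_cancel₀ (Nat.cast_ne_zero.2 Fintype.card_ne_zero), one_smul]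

/-- Averaging is a natural retraction of the unit of the adjunction. -/
def averageNatTrans (T : TensorAction k G C) : forget T ⋙ induction T ⟶ 𝟭 _ where
  app V := ⟨average V, average_comm V⟩
  naturality _ _ f := Hom.ext (average_naturality f)

theorem unit_comp_averageNatTrans [CharZero k] (V : Equivariantization T) :
    (forgetAdjInduction T).unit.app V ≫ (averageNatTrans T).app V = 𝟙 V :=
  Hom.ext (comp_average V _ (forgetAdjInduction_unit_π V))

end Averaging

end Equivariantization

theorem finiteType_iff_and_kdim_eq_of_isEquivariantizationOf (k : Type u) [Field k] [CharZero k]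
    (G : Type u) [Group G] [Finite G]
    {C : Type u₁} [Category.{v₁} C] [Abelian C] [Linear k C] [MonoidalCategory C]
    [MonoidalPreadditive C] [MonoidalLinear k C] [RigidCategory C]
    {D : Type u₂} [Category.{v₂} D] [Abelian D] [Linear k D] [MonoidalCategory D]
    [MonoidalPreadditive D] [MonoidalLinear k D] [RigidCategory D]
    (hC : IsFiniteTensorCategory k C) (hD : IsFiniteTensorCategory k D)
    (h : IsEquivariantizationOf k G D C) :
    (IsOfFiniteType k D ↔ IsOfFiniteType k C) ∧ (IsOfFiniteType k C → Kdim D = Kdim C) := by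
  obtain ⟨T, E, _, _, _, _⟩ := h
  have := Fintype.ofFinite G
  refine finiteType_iff_and_kdim_eq_of_adjunction k hC hD
    (F := E ⋙ Equivariantization.forget T) (I := Equivariantization.induction T ⋙ E.inv)
    (E.asEquivalence.toAdjunction.comp (Equivariantization.forgetAdjInduction T))
    ((Equivariantization.forget T).mapIso (Functor.Monoidal.εIso E).symm)
    (precompRetraction E.asEquivalence (Equivariantization.averageNatTrans T))
    (comp_precompRetraction _ _ _ Equivariantization.unit_comp_averageNatTrans)

/-! ### Modules over a commutative algebra in the Drinfeld center -/

section CentralAlgebra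

open scoped MonObj

variable {D : Type u₁} [Category.{v₁} D] [MonoidalCategory D]

/-- The half-braiding `b` makes `A` a commutative algebra in the Drinfeld center: the
multiplication and the unit of `A` are compatible with `b`, and `A` is commutative with respect
to `b`. -/
structure IsCentralAlgebra (A : Mon D) (b : HalfBraiding A.X) : Prop where
  mul_comm : (b.β A.X).hom ≫ μ[A.X] = μ[A.X]
  mul_braid (X : D) : μ[A.X] ▷ X ≫ (b.β X).hom = (α_ A.X A.X X).hom ≫ A.X ◁ (b.β X).hom ≫
    (α_ A.X X A.X).inv ≫ (b.β X).hom ▷ A.X ≫ (α_ X A.X A.X).hom ≫ X ◁ μ[A.X]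
  one_braid (X : D) : η[A.X] ▷ X ≫ (b.β X).hom = (λ_ X).hom ≫ (ρ_ X).inv ≫ X ◁ η[A.X]

variable {A : Mon D} {b : HalfBraiding A.X}

/-- The left action and the right action derived from it commute. The half-braiding of `A ⊗ X`
decomposes, and the resulting half-braiding of `A` with itself is absorbed by commutativity. -/
theorem IsCentralAlgebra.act_braid_act (hA : IsCentralAlgebra A b) {X : D} (l : A.X ⊗ X ⟶ X)
    (h : μ[A.X] ▷ X ≫ l = (α_ A.X A.X X).hom ≫ A.X ◁ l ≫ l) :
    l ▷ A.X ≫ (b.β X).inv ≫ l =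
      (α_ A.X X A.X).hom ≫ A.X ◁ (b.β X).inv ≫ A.X ◁ l ≫ l := by
  have n : l ▷ A.X ≫ (b.β X).inv = (b.β (A.X ⊗ X)).inv ≫ A.X ◁ l := by
    rw [Iso.comp_inv_eq, Category.assoc, b.naturality, Iso.inv_hom_id_assoc]
  rw [reassoc_of% n, Iso.inv_comp_eq, b.monoidal]
  simp only [Category.assoc, Iso.inv_hom_id_assoc, whiskerLeft_hom_inv_assoc]
  rw [← h, ← comp_whiskerRight_assoc, hA.mul_comm, h, Iso.inv_hom_id_assoc]

/-- A left module over a commutative algebra in the Drinfeld center is a bimodule, the right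
action being the left action composed with the inverse of the half-braiding. -/
def IsCentralAlgebra.bimod (hA : IsCentralAlgebra A b) (X : D) (l : A.X ⊗ X ⟶ X)
    (one : η[A.X] ▷ X ≫ l = (λ_ X).hom)
    (assoc : μ[A.X] ▷ X ≫ l = (α_ A.X A.X X).hom ≫ A.X ◁ l ≫ l) :
    (centralBimodules A b).FullSubcategory where
  obj :=
    { X := X
      actLeft := l
      one_actLeft := one
      left_assoc := assoc
      actRight := (b.β X).inv ≫ l
      actRight_one := by
        have h : X ◁ η[A.X] ≫ (b.β X).inv = (ρ_ X).hom ≫ (λ_ X).inv ≫ η[A.X] ▷ X := by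
          rw [Iso.comp_inv_eq, Category.assoc, Category.assoc, hA.one_braid]
          simp
        rw [reassoc_of% h, one, Iso.inv_hom_id, Category.comp_id]
      right_assoc := by
        have h : X ◁ μ[A.X] ≫ (b.β X).inv = (α_ X A.X A.X).inv ≫ (b.β X).inv ▷ A.X ≫
            (α_ A.X X A.X).hom ≫ A.X ◁ (b.β X).inv ≫ (α_ A.X A.X X).inv ≫ μ[A.X] ▷ X := by
          rw [Iso.comp_inv_eq]
          simp only [Category.assoc]
          rw [hA.mul_braid]
          simp
        rw [reassoc_of% h, comp_whiskerRight, Category.assoc, hA.act_braid_act l assoc, assoc,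
          Iso.inv_hom_id_assoc]
      middle_assoc := by
        rw [hA.act_braid_act l assoc, MonoidalCategory.whiskerLeft_comp, Category.assoc] }
  property := Iso.hom_inv_id_assoc _ _

/-- A morphism of left modules, as a morphism of central bimodules. -/
def homOfLeft {M N : (centralBimodules A b).FullSubcategory} (f : M.obj.X ⟶ N.obj.X)
    (hf : M.obj.actLeft ≫ f = A.X ◁ f ≫ N.obj.actLeft) : M ⟶ N :=
  ObjectProperty.homMk
    { hom := f
      left_act_hom := hf
      right_act_hom := by
        have hM : (b.β M.obj.X).hom ≫ M.obj.actRight = M.obj.actLeft := M.property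
        have hN : (b.β N.obj.X).hom ≫ N.obj.actRight = N.obj.actLeft := N.property
        rw [← cancel_epi (b.β M.obj.X).hom, reassoc_of% hM, hf, ← hN, b.naturality_assoc] }

variable (A b) in
/-- The functor that sends a central bimodule to its underlying object. -/
def centralForget : (centralBimodules A b).FullSubcategory ⥤ D :=
  (centralBimodules A b).ι ⋙ Bimod.forget A

instance : (Bimod.forget A : Bimod A A ⥤ D).Faithful where
  map_injective h := Bimod.hom_ext _ _ h

instance : (centralForget A b).Faithful := by
  unfold centralForget; infer_instance

theorem central_hom_ext {M N : (centralBimodules A b).FullSubcategory} {f g : M ⟶ N}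
    (h : (centralForget A b).map f = (centralForget A b).map g) : f = g :=
  (centralForget A b).map_injective h

theorem actLeft_comp_map {M N : (centralBimodules A b).FullSubcategory} (f : M ⟶ N) :
    M.obj.actLeft ≫ (centralForget A b).map f =
      A.X ◁ (centralForget A b).map f ≫ N.obj.actLeft :=
  Bimod.Hom.left_act_hom f.hom

variable (hA : IsCentralAlgebra A b)

/-- The free module `A ⊗ X`. -/
def IsCentralAlgebra.freeObj (X : D) : (centralBimodules A b).FullSubcategory :=
  hA.bimod (A.X ⊗ X) ((α_ A.X A.X X).inv ≫ μ[A.X] ▷ X)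
    (by
      rw [associator_inv_naturality_left_assoc, ← comp_whiskerRight, MonObj.one_mul]
      simp)
    (by
      rw [MonoidalCategory.whiskerLeft_comp, Category.assoc]
      have h := congrArg (fun t => t ▷ X) (MonObj.mul_assoc A.X)
      simp only [comp_whiskerRight] at h
      rw [associator_inv_naturality_left_assoc, h]
      rw [associator_inv_naturality_middle_assoc]
      monoidal)

/-- The extension `A ⊗ X ⟶ M` of a morphism `X ⟶ M` is a morphism of modules. -/
theorem mul_comp_act (M : Bimod A A) {X : D} (f : X ⟶ M.X) :
    ((α_ A.X A.X X).inv ≫ μ[A.X] ▷ X) ≫ A.X ◁ f ≫ M.actLeft =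
      A.X ◁ (A.X ◁ f ≫ M.actLeft) ≫ M.actLeft := by
  rw [Category.assoc, ← whisker_exchange_assoc, M.left_assoc, tensor_whiskerLeft]
  simp

/-- The extension of `f : X ⟶ M` to the free module restricts to `f`. -/
theorem one_comp_act (M : Bimod A A) {X : D} (f : X ⟶ M.X) :
    (λ_ X).inv ≫ η[A.X] ▷ X ≫ A.X ◁ f ≫ M.actLeft = f := by
  rw [← whisker_exchange_assoc, M.one_actLeft]
  simp

theorem whiskerLeft_one_comp_mul (A : Mon D) (X : D) :
    A.X ◁ ((λ_ X).inv ≫ η[A.X] ▷ X) ≫ (α_ A.X A.X X).inv ≫ μ[A.X] ▷ X = 𝟙 (A.X ⊗ X) := by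
  rw [MonoidalCategory.whiskerLeft_comp, Category.assoc, associator_inv_naturality_middle_assoc,
    ← comp_whiskerRight, MonObj.mul_one]
  simp

/-- A morphism of modules on the free module is the extension of its restriction. -/
theorem unit_comp_act (M : Bimod A A) {X : D} (φ : A.X ⊗ X ⟶ M.X)
    (hφ : ((α_ A.X A.X X).inv ≫ μ[A.X] ▷ X) ≫ φ = A.X ◁ φ ≫ M.actLeft) :
    A.X ◁ (((λ_ X).inv ≫ η[A.X] ▷ X) ≫ φ) ≫ M.actLeft = φ := by
  rw [MonoidalCategory.whiskerLeft_comp, Category.assoc, ← hφ, ← Category.assoc,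
    whiskerLeft_one_comp_mul, Category.id_comp]

theorem whiskerLeft_comp_act (M : Bimod A A) {X Y : D} (f : X ⟶ Y) (g : Y ⟶ M.X) :
    A.X ◁ (f ≫ g) ≫ M.actLeft = A.X ◁ f ≫ A.X ◁ g ≫ M.actLeft := by
  rw [MonoidalCategory.whiskerLeft_comp, Category.assoc]

theorem mul_comp_whiskerLeft (A : Mon D) {X Y : D} (f : X ⟶ Y) :
    ((α_ A.X A.X X).inv ≫ μ[A.X] ▷ X) ≫ A.X ◁ f =
      A.X ◁ A.X ◁ f ≫ (α_ A.X A.X Y).inv ≫ μ[A.X] ▷ Y := by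
  rw [Category.assoc, ← whisker_exchange, tensor_whiskerLeft]
  simp

/-- Morphisms of modules from the free module `A ⊗ X` to `M` are the morphisms from `X` to `M`. -/
def IsCentralAlgebra.freeHomEquiv (X : D) (M : (centralBimodules A b).FullSubcategory) :
    (hA.freeObj X ⟶ M) ≃ (X ⟶ M.obj.X) where
  toFun φ := ((λ_ X).inv ≫ η[A.X] ▷ X) ≫ (centralForget A b).map φ
  invFun f := homOfLeft (M := hA.freeObj X) (A.X ◁ f ≫ M.obj.actLeft) (mul_comp_act M.obj f)
  left_inv φ := central_hom_ext (unit_comp_act M.obj _ (actLeft_comp_map φ))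
  right_inv f := (Category.assoc _ _ _).trans (one_comp_act M.obj f)

/-- The free module functor `X ↦ A ⊗ X`. -/
def IsCentralAlgebra.free : D ⥤ (centralBimodules A b).FullSubcategory where
  obj := hA.freeObj
  map {X Y} f := homOfLeft (M := hA.freeObj X) (N := hA.freeObj Y) (A.X ◁ f)
    (mul_comp_whiskerLeft A f)
  map_id _ := central_hom_ext (MonoidalCategory.whiskerLeft_id _ _)
  map_comp _ _ := central_hom_ext (MonoidalCategory.whiskerLeft_comp _ _ _)

/-- The free module functor is left adjoint to the forgetful functor. -/
def IsCentralAlgebra.freeAdj : hA.free ⊣ centralForget A b :=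
  Adjunction.mkOfHomEquiv
    { homEquiv := hA.freeHomEquiv
      homEquiv_naturality_left_symm {_ _ M} _ _ :=
        central_hom_ext (whiskerLeft_comp_act M.obj _ _)
      homEquiv_naturality_right _ _ := (Category.assoc _ _ _).symm }

theorem IsCentralAlgebra.freeAdj_unit_app (X : D) :
    hA.freeAdj.unit.app X = (λ_ X).inv ≫ η[A.X] ▷ X :=
  Category.comp_id _

/-- A morphism `e : A ⟶ 𝟙` induces a natural transformation `A ⊗ X ⟶ X`. -/
def IsCentralAlgebra.freeRetraction (e : A.X ⟶ 𝟙_ D) : hA.free ⋙ centralForget A b ⟶ 𝟭 D where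
  app X := e ▷ X ≫ (λ_ X).hom
  naturality X Y f := by
    have h : A.X ◁ f ≫ e ▷ Y ≫ (λ_ Y).hom = (e ▷ X ≫ (λ_ X).hom) ≫ f := by
      rw [whisker_exchange_assoc]
      simp
    exact h

theorem IsCentralAlgebra.unit_comp_freeRetraction {e : A.X ⟶ 𝟙_ D} (he : η[A.X] ≫ e = 𝟙 _)
    (X : D) : hA.freeAdj.unit.app X ≫ (hA.freeRetraction e).app X = 𝟙 X := by
  have h : ((λ_ X).inv ≫ η[A.X] ▷ X) ≫ e ▷ X ≫ (λ_ X).hom = 𝟙 X := by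
    rw [Category.assoc, ← comp_whiskerRight_assoc, he]
    simp
  exact (congrArg (· ≫ _) (hA.freeAdj_unit_app X)).trans h

/-- The free module on the unit object is `A`. -/
def IsCentralAlgebra.freeUnitIso (M : (centralBimodules A b).FullSubcategory)
    (hM : M.obj = Bimod.regular A) : hA.freeObj (𝟙_ D) ≅ M := by
  obtain ⟨M, p⟩ := M
  subst hM
  exact
    { hom := homOfLeft (M := hA.freeObj (𝟙_ D)) (ρ_ A.X).hom (by
        change ((α_ A.X A.X (𝟙_ D)).inv ≫ μ[A.X] ▷ 𝟙_ D) ≫ (ρ_ A.X).hom =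
          A.X ◁ (ρ_ A.X).hom ≫ μ[A.X]
        simp)
      inv := homOfLeft (N := hA.freeObj (𝟙_ D)) (ρ_ A.X).inv (by
        change μ[A.X] ≫ (ρ_ A.X).inv =
          A.X ◁ (ρ_ A.X).inv ≫ (α_ A.X A.X (𝟙_ D)).inv ≫ μ[A.X] ▷ 𝟙_ D
        rw [rightUnitor_inv_naturality]
        simp)
      hom_inv_id := central_hom_ext (Iso.hom_inv_id (ρ_ A.X))
      inv_hom_id := central_hom_ext (Iso.inv_hom_id (ρ_ A.X)) }

section Preadditive

variable [Preadditive D] [MonoidalPreadditive D]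

instance : hA.free.Additive where
  map_add {_ _ _ _} := central_hom_ext (MonoidalPreadditive.whiskerLeft_add _ _)

instance : (centralForget A b).Additive where

instance (k : Type u) [Field k] [Linear k D] [MonoidalLinear k D] : hA.free.Linear k where
  map_smul f c := central_hom_ext (MonoidalLinear.whiskerLeft_smul _ c f)

end Preadditive

section Abelian

variable [Abelian D] [MonoidalPreadditive D] [RigidCategory D]

/-- Tensoring with `A` is exact, and the forgetful functor is faithful. -/
instance : hA.free.PreservesMonomorphisms where
  preserves f hf := by
    have h : Mono ((centralForget A b).map (hA.free.map f)) :=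
      inferInstanceAs (Mono ((tensorLeft A.X).map f))
    have := Functor.reflectsMonomorphisms_of_faithful (centralForget A b)
    exact (centralForget A b).mono_of_mono_map h

/-- The action on the cokernel of a morphism of modules. -/
def cokernelAct {M N : Bimod A A} (f : M ⟶ N) :
    {l : A.X ⊗ cokernel f.hom ⟶ cokernel f.hom //
      A.X ◁ cokernel.π f.hom ≫ l = N.actLeft ≫ cokernel.π f.hom} :=
  CokernelCofork.IsColimit.desc'
    (isColimitCoforkMapOfIsColimit' (tensorLeft A.X) (cokernel.condition f.hom)
      (cokernelIsCokernel f.hom)) (N.actLeft ≫ cokernel.π f.hom) (by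
        change A.X ◁ f.hom ≫ N.actLeft ≫ cokernel.π f.hom = 0
        rw [← f.left_act_hom_assoc, cokernel.condition, comp_zero])

instance epi_whiskerLeft (X : D) {Y Z : D} (f : Y ⟶ Z) [Epi f] : Epi (X ◁ f) :=
  inferInstanceAs (Epi ((tensorLeft X).map f))

/-- The cokernel of a morphism of modules is a module. -/
def IsCentralAlgebra.cokernelObj {M N : Bimod A A} (f : M ⟶ N) :
    (centralBimodules A b).FullSubcategory :=
  hA.bimod (cokernel f.hom) (cokernelAct f).1
    (by
      rw [← cancel_epi (𝟙_ D ◁ cokernel.π f.hom), whisker_exchange_assoc, (cokernelAct f).2]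
      simp)
    (by
      rw [← cancel_epi ((A.X ⊗ A.X) ◁ cokernel.π f.hom), whisker_exchange_assoc,
        (cokernelAct f).2, tensor_whiskerLeft]
      simp only [Category.assoc, Iso.inv_hom_id_assoc]
      rw [← MonoidalCategory.whiskerLeft_comp_assoc, (cokernelAct f).2,
        MonoidalCategory.whiskerLeft_comp_assoc, (cokernelAct f).2]
      simp)

include hA in
/-- If `f` is an epimorphism of modules, the projection onto its cokernel in `D`, being a morphism
of modules, is zero. -/
theorem IsCentralAlgebra.preservesEpimorphisms_forget :
    (centralForget A b).PreservesEpimorphisms where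
  preserves {M N} f hf := by
    refine Preadditive.epi_of_cokernel_zero ?_
    let q : N ⟶ hA.cokernelObj f.hom :=
      homOfLeft (cokernel.π f.hom.hom) (cokernelAct f.hom).2.symm
    have h : f ≫ q = 0 := central_hom_ext (cokernel.condition f.hom.hom)
    have h' : q = 0 := by rw [← cancel_epi f, h, comp_zero]
    exact congrArg (centralForget A b).map h'

end Abelian

end CentralAlgebra

section CentralModules

open scoped MonObj

variable {D : Type u₁} [Category.{v₁} D] [MonoidalCategory D]

theorem isCentralAlgebra_centralMon (Z : Center D) [MonObj Z] [IsCommMonObj Z] :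
    IsCentralAlgebra (centralMon Z) Z.2 := by
  have hμ : μ[(centralMon Z).X] = (μ[Z]).f := Category.id_comp _
  have hη : η[(centralMon Z).X] = (η[Z]).f := Category.id_comp _
  refine ⟨?_, fun X => ?_, fun X => ?_⟩
  · rw [hμ]
    exact congrArg Center.Hom.f (IsCommMonObj.mul_comm Z)
  · rw [hμ]
    refine ((μ[Z]).comm X).trans ?_
    rw [Center.tensor_β]
    simp only [Iso.trans_hom, whiskerLeftIso_hom, Iso.symm_hom, whiskerRightIso_hom]
    exact (Category.assoc _ _ _).trans (congrArg (_ ≫ ·) ((Category.assoc _ _ _).trans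
      (congrArg (_ ≫ ·) ((Category.assoc _ _ _).trans (congrArg (_ ≫ ·) (Category.assoc _ _ _))))))
  · rw [hη]
    refine ((η[Z]).comm X).trans ?_
    rw [Center.tensorUnit_β]
    exact Category.assoc _ _ _

end CentralModules

/-! ### Averaging functions on a finite group -/

section Average

open scoped MonObj

variable (k : Type u) [Field k] (G : Type u) [Fintype G]

/-- The average of the values of a function on `G`. -/
def averageValue : (G → k) →ₗ[k] k := (Fintype.card G : k)⁻¹ • ∑ x : G, LinearMap.proj x

theorem averageValue_apply (f : G → k) :
    averageValue k G f = (Fintype.card G : k)⁻¹ * ∑ x, f x := by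
  simp [averageValue]

variable [Group G]

/-- Averaging, as a morphism from `O(G)` to the trivial representation. -/
def functionAverage : functionAlgebra k G ⟶ 𝟙_ (FDRep k G) where
  hom := FGModuleCat.ofHom (V := G → k) (W := k) (averageValue k G)
  comm g := by
    apply FGModuleCat.hom_ext
    refine LinearMap.ext fun (f : G → k) => ?_
    change averageValue k G (fun x => f (g⁻¹ * x)) = averageValue k G f
    rw [averageValue_apply, averageValue_apply,
      Fintype.sum_equiv (Equiv.mulLeft g⁻¹) (fun x => f (g⁻¹ * x)) f fun _ => rfl]

theorem functionUnit_comp_functionAverage [CharZero k] :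
    functionUnit k G ≫ functionAverage k G = 𝟙 _ := by
  apply Action.Hom.ext
  apply FGModuleCat.hom_ext
  refine LinearMap.ext fun (c : k) => ?_
  change averageValue k G (fun _ => c) = c
  simp [averageValue_apply]

variable {k G} in
/-- The image of averaging under a central embedding retracts the unit of the algebra in `D`. -/
theorem exists_retraction_unit [CharZero k] {D : Type u₁} [Category.{v₁} D] [Abelian D]
    [Linear k D] [MonoidalCategory D] (Q : CentralEmbedding k G D) :
    open scoped Obj in
    ∃ e : (centralMon Q.algebra).X ⟶ 𝟙_ D, η[(centralMon Q.algebra).X] ≫ e = 𝟙 _ := by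
  open scoped Obj in
  have h : η[Q.algebra] ≫ Q.lift.map (functionAverage k G) ≫
      Functor.OplaxMonoidal.η Q.lift = 𝟙 _ := by
    change (Functor.LaxMonoidal.ε Q.lift ≫ Q.lift.map (functionUnit k G)) ≫ _ = _
    rw [Category.assoc, ← Functor.map_comp_assoc, functionUnit_comp_functionAverage,
      CategoryTheory.Functor.map_id, Category.id_comp, Functor.Monoidal.ε_η]
  refine ⟨(Q.lift.map (functionAverage k G) ≫ Functor.OplaxMonoidal.η Q.lift).f, ?_⟩
  refine Eq.trans ?_ (congrArg Center.Hom.f h)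
  exact congrArg (· ≫ _) (Category.id_comp _)

end Average

/-- The left adjoint is the free module functor, its right adjoint forgets the module structure, and
a retraction of the unit of `A` retracts the unit of the adjunction. -/
theorem finiteType_iff_and_kdim_eq_of_isCentralAlgebra (k : Type u) [Field k]
    {C : Type u₁} [Category.{v₁} C] [Abelian C] [Linear k C] [MonoidalCategory C]
    [MonoidalPreadditive C] [MonoidalLinear k C] [RigidCategory C]
    {D : Type u₂} [Category.{v₂} D] [Abelian D] [Linear k D] [MonoidalCategory D]
    [MonoidalPreadditive D] [MonoidalLinear k D] [RigidCategory D]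
    (hC : IsFiniteTensorCategory k C) (hD : IsFiniteTensorCategory k D)
    {A : Mon D} {b : HalfBraiding A.X} (hA : IsCentralAlgebra A b)
    {r : A.X ⟶ 𝟙_ D} (hr : MonObj.one ≫ r = 𝟙 _)
    (E : C ⥤ (centralBimodules A b).FullSubcategory) [E.IsEquivalence] [E.Additive] [E.Linear k]
    {M : (centralBimodules A b).FullSubcategory} (hM : M.obj = Bimod.regular A)
    (e : M ≅ E.obj (𝟙_ C)) :
    (IsOfFiniteType k D ↔ IsOfFiniteType k C) ∧ (IsOfFiniteType k C → Kdim D = Kdim C) := by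
  have := hA.preservesEpimorphisms_forget
  have : E.asEquivalence.functor.Additive := inferInstanceAs E.Additive
  have : E.asEquivalence.functor.Linear k := inferInstanceAs (E.Linear k)
  have : E.inv.Additive := Equivalence.inverse_additive E.asEquivalence
  have : E.inv.Linear k := Equivalence.inverseLinear k E.asEquivalence
  exact finiteType_iff_and_kdim_eq_of_adjunction k hC hD
    (F := hA.free ⋙ E.inv) (I := E ⋙ centralForget A b)
    (hA.freeAdj.comp E.asEquivalence.symm.toAdjunction)
    (E.inv.mapIso (hA.freeUnitIso M hM ≪≫ e) ≪≫ (E.asEquivalence.unitIso.app (𝟙_ C)).symm)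
    (postcompRetraction E.asEquivalence (hA.freeRetraction r))
    (comp_postcompRetraction _ _ _ (hA.unit_comp_freeRetraction hr))

theorem finiteType_iff_and_kdim_eq_of_isDeEquivariantizationOf (k : Type u) [Field k] [CharZero k]
    (G : Type u) [Group G] [Finite G]
    {C : Type u₁} [Category.{v₁} C] [Abelian C] [Linear k C] [MonoidalCategory C]
    [MonoidalPreadditive C] [MonoidalLinear k C] [RigidCategory C]
    {D : Type u₂} [Category.{v₂} D] [Abelian D] [Linear k D] [MonoidalCategory D]
    [MonoidalPreadditive D] [MonoidalLinear k D] [RigidCategory D]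
    (hC : IsFiniteTensorCategory k C) (hD : IsFiniteTensorCategory k D)
    (h : IsDeEquivariantizationOf k G C D) :
    (IsOfFiniteType k D ↔ IsOfFiniteType k C) ∧ (IsOfFiniteType k C → Kdim D = Kdim C) := by
  obtain ⟨Q, E, _, h₁, h₂, h₃⟩ := h
  have := Fintype.ofFinite G
  obtain ⟨r, hr⟩ := exists_retraction_unit Q
  open scoped Obj in
  let F : C ⥤ (centralBimodules (centralMon Q.algebra) Q.algebra.2).FullSubcategory := E
  have : F.IsEquivalence := h₁
  have : F.Additive := h₂
  have : F.Linear k := h₃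
  exact finiteType_iff_and_kdim_eq_of_isCentralAlgebra k hC hD
    (isCentralAlgebra_centralMon Q.algebra) hr F (M := 𝟙_ (DeEquivariantization Q)) rfl
    (Functor.Monoidal.εIso E)

end FinTensor

end

theorem mainTheorem6 (k : Type u) [Field k] [CharZero k] (G : Type u) [Group G] [Finite G]
    (C : Type u₁) [Category.{v₁} C] [Abelian C] [Linear k C] [MonoidalCategory C]
    [MonoidalPreadditive C] [MonoidalLinear k C] [RigidCategory C]
    (D : Type u₂) [Category.{v₂} D] [Abelian D] [Linear k D] [MonoidalCategory D]
    [MonoidalPreadditive D] [MonoidalLinear k D] [RigidCategory D]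
    (hC : FinTensor.IsFiniteTensorCategory k C) (hD : FinTensor.IsFiniteTensorCategory k D)
    (h : FinTensor.IsEquivariantizationOf k G D C ∨ FinTensor.IsDeEquivariantizationOf k G C D) :
    (FinTensor.IsOfFiniteType k D ↔ FinTensor.IsOfFiniteType k C) ∧
      (FinTensor.IsOfFiniteType k C → FinTensor.Kdim D = FinTensor.Kdim C) := by
  rcases h with h | h
  · exact FinTensor.finiteType_iff_and_kdim_eq_of_isEquivariantizationOf k G hC hD h
  · exact FinTensor.finiteType_iff_and_kdim_eq_of_isDeEquivariantizationOf k G hC hD h
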